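/- **Conventions.** Let $q\in\mathbb C^*$ not be a root of unity and let $s\ge 0$ be an integer or a half-integer. Write $b(x)=x-x^{-1}$, $[n]_q=\frac{q^n-q^{-n}}{q-q^{-1}}$, $(a;p)_n=\prod_{k=0}^{n-1}(1-ap^k)$, and $(a_1,\dots,a_m;p)_n=\prod_i(a_i;p)_n$. Let $\mathrm b,\mathrm c,\mathrm b^*,\mathrm c^*,\mathrm b^\diamond,\mathrm c^\diamond,r_0,\zeta\in\mathbb C^*$ satisfy $r_0^{-2}=\mathrm b\mathrm c=\mathrm b^*\mathrm c^*=\mathrm b^\diamond\mathrm c^\diamond$, $\zeta^{-2}=\mathrm b^\diamond r_0q^{2s}$, $\zeta^{2}=\mathrm c^\diamond r_0q^{-2s}$, and the following (Leonard triple) conditions: (i) $\mathrm b/\mathrm c$, $\mathrm b^*/\mathrm c^*$, $\mathrm b^\diamond/\mathrm c^\diamond$ are different from $q^{-2M}$ for $1\le M\le 4s-1$; (ii) $\mathrm c^*\ne -r_0q^{-2M+1}\mathrm c\,\mathrm c^\diamond$, $\mathrm b\ne -r_0q^{-2M+1+4s}\mathrm b^*\mathrm b^\diamond$, $\mathrm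 c\ne -r_0q^{2M+4s-1}\mathrm b^*\mathrm b^\diamond$, $\mathrm c^*\ne -r_0q^{2M-1}\mathrm b\,\mathrm c^\diamond$ for $1\le M\le 2s$. Assume also $\mathrm b^\diamond/\mathrm c^\diamond\notin\{1,q^{-8s}\}$, so that the coefficients $k_M$ below have nonzero denominators. Put $\theta^*_M=\mathrm b^*q^{2M}+\mathrm c^*q^{-2M}$ and $\theta^\diamond_M=\mathrm b^\diamond q^{2M}+\mathrm c^\diamond q^{-2M}$. **Bethe equations.** Let $$f(u,v)=\frac{b(qv/u)b(uv)}{b(v/u)b(quv)},\qquad h(u,v)=\frac{b(q^2uv)b(qu/v)}{b(quv)b(u/v)},$$ and for $\epsilon=\pm1$ $$\Lambda_1^\epsilon(u)=\frac{q^{-2s-1}}{u^\epsilon}\Big(q^{2s+1}u\zeta^{-1}-u^{-1}\zeta\Big)\Big(q^{2s+1}u\zeta-u^{-1}\zeta^{-1}\Big)\Big(u\mathrm c^*q^{-2s}+u^{-1}\mathrm bq^{2s}\Big)\Big(u\big(\tfrac{\mathrm c}{\mathrm c^*}\big)^{\frac{1-\epsilon}2}+u^{-1}\big(\tfrac{\mathrm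 b^*}{\mathrm b}\big)^{\frac{1+\epsilon}2}\Big),$$ $$\Lambda_2^\epsilon(u)=\frac{b(u^2)q^{-2s-1}}{u^\epsilon b(qu^2)}\Big(q^{2s-1}u^{-1}\zeta-u\zeta^{-1}\Big)\Big(q^{2s-1}u^{-1}\zeta^{-1}-u\zeta\Big)\Big(q^2u\mathrm bq^{2s}+u^{-1}\mathrm c^*q^{-2s}\Big)\Big(q^2u\big(\tfrac{\mathrm b^*}{\mathrm b}\big)^{\frac{1+\epsilon}2}+u^{-1}\big(\tfrac{\mathrm c}{\mathrm c^*}\big)^{\frac{1-\epsilon}2}\Big).$$ The homogeneous Bethe function of $u_1,\dots,u_N$ is $$E_+^N(u_i,\bar u_i)=-\frac{b(u_i^2)}{b(qu_i^2)}\prod_{j\ne i}f(u_i,u_j)\,\Lambda_1^+(u_i)+\prod_{j\ne i}h(u_i,u_j)\,\Lambda_2^+(u_i),$$ and the inhomogeneous Bethe function of $u_1,\dots,u_{2s}$ is $$E_-(u_i,\bar u_i)=\frac{b(u_i^2)}{b(qu_i^2)}u_i^{-1}\prod_{j\ne i}f(u_i,u_j)\Lambda_1^-(u_i)-q^2u_i^3\prod_{j\ne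 i}h(u_i,u_j)\Lambda_2^-(u_i)+q^{1+4s}\mathrm b\,\frac{u_i^2b(u_i^2)}{b(q)}\,\frac{\prod_{k=0}^{2s}b(q^{1/2+k-s}\zeta u_i)\,b(q^{1/2+k-s}\zeta^{-1}u_i)}{\prod_{j\ne i}b(u_iu_j^{-1})\,b(qu_iu_j)} .$$ The symmetric variable of $u$ is $U=\frac{qu^2+q^{-1}u^{-2}}{q+q^{-1}}$. A tuple $(u_i)$ is *admissible* if $u_i\ne0$, $u_i^2\ne u_i^{-2}$ and $b(qu_i^2)\ne0$ for all $i$, and $U_i\ne U_j$ for $i\ne j$. A *solution* of either system is an admissible tuple on which all its Bethe functions vanish; solutions are counted through the multisets $\{U_j\}$, that is, up to permutation of their symmetric variables. **Coefficients.** For $0\le M\le 2s$ and a scalar $h_0\in\mathbb C^*$ let $$h_M=h_0\prod_{k=0}^{M-1}q^{4k}\,\frac{\mathrm b^\diamond}{\mathrm c^\diamond}\,\frac{\mathrm c^\diamond q^{-2k}+r_0q\,\mathrm c^*\mathrm b}{\mathrm b^\diamond q^{2k}+r_0q^{-1}\mathrm c^*\mathrm b},$$ $$k_M=\frac{\big(-\frac{\mathrm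 b^\diamond\mathrm c^*}{\mathrm c}r_0q,\ -\frac{\mathrm b\mathrm b^*}{\mathrm c^\diamond}r_0q^{4s+1},\ \frac{\mathrm b^\diamond}{\mathrm c^\diamond},\ q^{-4s};q^2\big)_M}{\big(q^2,\ -\frac{\mathrm b^\diamond\mathrm c^*}{\mathrm b}r_0q^{1-4s},\ -\frac{\mathrm c\,\mathrm b^*}{\mathrm c^\diamond}r_0q,\ \frac{\mathrm b^\diamond}{\mathrm c^\diamond}q^{4s+2};q^2\big)_M}\cdot\frac{1-\frac{\mathrm b^\diamond}{\mathrm c^\diamond}q^{4M}}{(\mathrm b/\mathrm c)^M\,(1-\frac{\mathrm b^\diamond}{\mathrm c^\diamond})}$$ (this is $k_M^{\{.,\diamond,*\}}$). **Proposition.** Let $0\le N\le 2s$ be an integer. Assume *Hypothesis 1:* the system $E_+^N(u_i,\bar u_i)=0$, $i=1,\dots,N$, has a unique solution up to permutation; *Hypothesis 2:* the system $E_-(u_i,\bar u_i)=0$, $i=1,\dots,2s$, has exactly $2s+1$ distinct solutions up to permutation. Let $U^{(h)}_1,\dots,U^{(h)}_N$ be the symmetric variables of a solution of $E_+^N=0$.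 Let $U^{(i)}_1,\dots,U^{(i)}_{2s}$ be the symmetric variables of a solution $(u_j)$ of $E_-=0$ associated with $\theta^*_N$, i.e. such that $$\theta^*_N=q^{4s}\Big(\mathrm b(\zeta^2+\zeta^{-2})[2s]_q+q^{-2s}(\mathrm b^*q^{2s}+\mathrm c^*q^{-2s})-q^{-1}\mathrm b\sum_{j=1}^{2s}(qu_j^2+q^{-1}u_j^{-2})\Big).$$ Then both denominators below are nonzero, and for every $M'=0,1,\dots,2s$ $$\frac{\prod_{j=1}^{2s}\Big(U^{(i)}_j-\frac{r_0}{q+q^{-1}}\theta^\diamond_{M'}\Big)}{\sum_{M=0}^{2s}\prod_{j=1}^{2s}\Big(U^{(i)}_j-\frac{r_0}{q+q^{-1}}\theta^\diamond_{M}\Big)k_{M}}=\frac{\frac1{h_{M'}}\prod_{j=1}^{N}\Big(U^{(h)}_j-\frac{r_0}{q+q^{-1}}\theta^\diamond_{M'}\Big)}{\sum_{M=0}^{2s}\frac1{h_{M}}\prod_{j=1}^{N}\Big(U^{(h)}_j-\frac{r_0}{q+q^{-1}}\theta^\diamond_{M}\Big)k_{M}} .$$ Moreover these relations determine the inhomogeneous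 roots: if $V_1,\dots,V_{2s}\in\mathbb C$ satisfy the same $2s+1$ relations in place of $U^{(i)}_1,\dots,U^{(i)}_{2s}$ (with nonzero denominator), then $(V_j)$ is a permutation of $(U^{(i)}_j)$. -/

import Mathlib

open Finset

noncomputable section

namespace BetheRacah

/-- `b(x) = x - x⁻¹`. -/
def bfun (x : ℂ) : ℂ := x - x⁻¹

/-- The `q`-integer `[k]_q`. -/
def qInt (q : ℂ) (k : ℕ) : ℂ := (q ^ k - (q ^ k)⁻¹) / (q - q⁻¹)

/-- The `q`-shifted factorial `(a; p)_k`. -/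
def qPoch (a p : ℂ) (k : ℕ) : ℂ := ∏ i ∈ range k, (1 - a * p ^ i)

/-- The scalar parameters of a Leonard triple `(A, A*, A◇)` of `q`-Racah type of diameter `n = 2s`:
`(b, c)`, `(bs, cs)`, `(bd, cd)` parametrize the spectra of `A`, `A*`, `A◇`, and `ζ` is the
parameter of the Bethe equations. -/
structure Params where
  /-- the integer `2s` -/
  n : ℕ
  q : ℂ
  r₀ : ℂ
  ζ : ℂ
  b : ℂ
  c : ℂ
  bs : ℂ
  cs : ℂ
  bd : ℂ
  cd : ℂ

/-- The eigenvalues `β q^{2M} + γ q^{-2M}`. -/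
def eigval (q β γ : ℂ) (M : ℕ) : ℂ := β * q ^ (2 * M) + γ * q ^ (-(2 * M : ℤ))

/-- The standing assumptions on the parameters of the Leonard triple. The family of inequalities
`ne₁`, ..., `ne₄` is invariant under permutations of the three pairs `(b, c)`, `(bs, cs)`,
`(bd, cd)`, because `r₀⁻² = b c = bs cs = bd cd`. -/
structure Params.Valid (P : Params) : Prop where
  q_ne : P.q ≠ 0
  q_not_root : ∀ k : ℕ, 0 < k → P.q ^ k ≠ 1
  r₀_ne : P.r₀ ≠ 0
  b_ne : P.b ≠ 0
  c_ne : P.c ≠ 0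
  bs_ne : P.bs ≠ 0
  cs_ne : P.cs ≠ 0
  bd_ne : P.bd ≠ 0
  cd_ne : P.cd ≠ 0
  ζ_ne : P.ζ ≠ 0
  r₀_eq : P.r₀ ^ (-2 : ℤ) = P.b * P.c
  r₀_eqs : P.r₀ ^ (-2 : ℤ) = P.bs * P.cs
  r₀_eqd : P.r₀ ^ (-2 : ℤ) = P.bd * P.cd
  ζ_eq : P.ζ ^ (-2 : ℤ) = P.bd * P.r₀ * P.q ^ P.n
  ζ_eq' : P.ζ ^ 2 = P.cd * P.r₀ * P.q ^ (-(P.n : ℤ))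
  spec : ∀ M : ℕ, 1 ≤ M → M < 2 * P.n → P.b / P.c ≠ P.q ^ (-(2 * M : ℤ))
  spec_s : ∀ M : ℕ, 1 ≤ M → M < 2 * P.n → P.bs / P.cs ≠ P.q ^ (-(2 * M : ℤ))
  spec_d : ∀ M : ℕ, 1 ≤ M → M < 2 * P.n → P.bd / P.cd ≠ P.q ^ (-(2 * M : ℤ))
  ne₁ : ∀ M : ℕ, 1 ≤ M → M ≤ P.n →
    P.cs ≠ -(P.r₀ * P.q ^ (-(2 * M : ℤ) + 1) * P.c * P.cd)
  ne₂ : ∀ M : ℕ, 1 ≤ M → M ≤ P.n →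
    P.b ≠ -(P.r₀ * P.q ^ (-(2 * M : ℤ) + 1 + 2 * P.n) * P.bs * P.bd)
  ne₃ : ∀ M : ℕ, 1 ≤ M → M ≤ P.n →
    P.c ≠ -(P.r₀ * P.q ^ ((2 * M : ℤ) + 2 * P.n - 1) * P.bs * P.bd)
  ne₄ : ∀ M : ℕ, 1 ≤ M → M ≤ P.n →
    P.cs ≠ -(P.r₀ * P.q ^ ((2 * M : ℤ) - 1) * P.b * P.cd)

/-! ### Bethe equations -/

/-- The exchange function `f(u, v)`. -/
def fExch (q u v : ℂ) : ℂ :=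
  bfun (q * v / u) * bfun (u * v) / (bfun (v / u) * bfun (q * u * v))

/-- The exchange function `h(u, v)`. -/
def hExch (q u v : ℂ) : ℂ :=
  bfun (q ^ 2 * u * v) * bfun (q * u / v) / (bfun (q * u * v) * bfun (u / v))

/-- `Λ₁^ε(u)`, for `ε = 1` or `ε = -1`. -/
def Lambda₁ (P : Params) (ε : ℤ) (u : ℂ) : ℂ :=
  P.q ^ (-(P.n : ℤ) - 1) / u ^ ε
    * (P.q ^ (P.n + 1) * u * P.ζ⁻¹ - u⁻¹ * P.ζ)
    * (P.q ^ (P.n + 1) * u * P.ζ - u⁻¹ * P.ζ⁻¹)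
    * (u * P.cs * P.q ^ (-(P.n : ℤ)) + u⁻¹ * P.b * P.q ^ P.n)
    * (u * (P.c / P.cs) ^ ((1 - ε) / 2) + u⁻¹ * (P.bs / P.b) ^ ((1 + ε) / 2))

/-- `Λ₂^ε(u)`, for `ε = 1` or `ε = -1`. -/
def Lambda₂ (P : Params) (ε : ℤ) (u : ℂ) : ℂ :=
  (u ^ 2 - u ^ (-2 : ℤ)) * P.q ^ (-(P.n : ℤ) - 1)
      / (u ^ ε * (P.q * u ^ 2 - P.q⁻¹ * u ^ (-2 : ℤ)))
    * (P.q ^ ((P.n : ℤ) - 1) * u⁻¹ * P.ζ - u * P.ζ⁻¹)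
    * (P.q ^ ((P.n : ℤ) - 1) * u⁻¹ * P.ζ⁻¹ - u * P.ζ)
    * (P.q ^ 2 * u * P.b * P.q ^ P.n + u⁻¹ * P.cs * P.q ^ (-(P.n : ℤ)))
    * (P.q ^ 2 * u * (P.bs / P.b) ^ ((1 + ε) / 2) + u⁻¹ * (P.c / P.cs) ^ ((1 - ε) / 2))

/-- The function `E_+^N(u_i, ū_i)` of the homogeneous Bethe equations. -/
def homBethe (P : Params) {N : ℕ} (u : Fin N → ℂ) (i : Fin N) : ℂ :=
  -(bfun (u i ^ 2) / bfun (P.q * u i ^ 2))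
      * (∏ j ∈ univ.erase i, fExch P.q (u i) (u j)) * Lambda₁ P 1 (u i)
    + (∏ j ∈ univ.erase i, hExch P.q (u i) (u j)) * Lambda₂ P 1 (u i)

/-- The function `E_-(u_i, ū_i)` of the inhomogeneous Bethe equations, for `n = 2s` variables.
The half-integer powers `q^{1/2+k-s}` enter only through their squares, so the choice of a branch
is immaterial. -/
def inhomBethe (P : Params) (u : Fin P.n → ℂ) (i : Fin P.n) : ℂ :=
  bfun (u i ^ 2) / bfun (P.q * u i ^ 2) * (u i)⁻¹
      * (∏ j ∈ univ.erase i, fExch P.q (u i) (u j)) * Lambda₁ P (-1) (u i)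
    - P.q ^ 2 * u i ^ 3
      * (∏ j ∈ univ.erase i, hExch P.q (u i) (u j)) * Lambda₂ P (-1) (u i)
    + P.q ^ (1 + 2 * P.n) * P.b * (u i ^ 2 * bfun (u i ^ 2) / bfun P.q)
      * ((∏ k ∈ range (P.n + 1),
            bfun (P.q ^ ((1 / 2 : ℂ) + k - P.n / 2) * P.ζ * u i)
              * bfun (P.q ^ ((1 / 2 : ℂ) + k - P.n / 2) * P.ζ⁻¹ * u i))
          / ∏ j ∈ univ.erase i, bfun (u i * (u j)⁻¹) * bfun (P.q * u i * u j))

/-- The symmetric variable `U = (q u² + q⁻¹ u⁻²) / (q + q⁻¹)`. -/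
def symVar (q u : ℂ) : ℂ := (q * u ^ 2 + q⁻¹ * u ^ (-2 : ℤ)) / (q + q⁻¹)

/-- Admissible tuples. The first condition in the second line says that the Bethe functions are
defined; their remaining denominators `b(u_i/u_j) b(q u_i u_j)` are nonzero multiples of
`U_i - U_j`. -/
def Admissible (q : ℂ) {N : ℕ} (u : Fin N → ℂ) : Prop :=
  (∀ i, u i ≠ 0) ∧ (∀ i, u i ^ 2 ≠ u i ^ (-2 : ℤ)) ∧
  (∀ i, q * u i ^ 2 ≠ q⁻¹ * u i ^ (-2 : ℤ)) ∧
  ∀ i j, i ≠ j → symVar q (u i) ≠ symVar q (u j)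

/-- `u` is an admissible solution of the homogeneous Bethe equations `E_+^N = 0`. -/
def IsHomRoots (P : Params) {N : ℕ} (u : Fin N → ℂ) : Prop :=
  Admissible P.q u ∧ ∀ i, homBethe P u i = 0

/-- `u` is an admissible solution of the inhomogeneous Bethe equations `E_- = 0`. -/
def IsInhomRoots (P : Params) (u : Fin P.n → ℂ) : Prop :=
  Admissible P.q u ∧ ∀ i, inhomBethe P u i = 0

/-- The unordered collection of the symmetric variables of a tuple. -/
def symRoots (q : ℂ) {N : ℕ} (u : Fin N → ℂ) : Multiset ℂ :=
  (univ : Finset (Fin N)).val.map fun i => symVar q (u i)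

/-- The homogeneous system has a unique admissible solution in the symmetric variables, up to
permutation. -/
def HomHypothesis (P : Params) (N : ℕ) : Prop :=
  ∃! W : Multiset ℂ, ∃ u : Fin N → ℂ, IsHomRoots P u ∧ symRoots P.q u = W

/-- The inhomogeneous system has exactly `2s + 1` distinct admissible solutions in the symmetric
variables, up to permutation. -/
def InhomHypothesis (P : Params) : Prop :=
  {W : Multiset ℂ | ∃ u : Fin P.n → ℂ, IsInhomRoots P u ∧ symRoots P.q u = W}.ncard = P.n + 1

/-- The eigenvalue of `A*` carried by a solution of the inhomogeneous Bethe equations. -/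
def inhomEigenvalue (P : Params) (u : Fin P.n → ℂ) : ℂ :=
  P.q ^ (2 * P.n) *
    (P.b * (P.ζ ^ 2 + P.ζ ^ (-2 : ℤ)) * qInt P.q P.n
      + P.q ^ (-(P.n : ℤ)) * (P.bs * P.q ^ P.n + P.cs * P.q ^ (-(P.n : ℤ)))
      - P.q⁻¹ * P.b * ∑ j, (P.q * u j ^ 2 + P.q⁻¹ * u j ^ (-2 : ℤ)))

/-! ### Coefficients of the transition matrices -/

/-- `h_M = h₀ ∏_{k<M} 𝔥(k)`. -/
def hCoeff (P : Params) (h₀ : ℂ) (M : ℕ) : ℂ :=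
  h₀ * ∏ k ∈ range M,
    (P.q ^ (4 * k) * (P.bd / P.cd)
      * ((P.cd * P.q ^ (-(2 * k : ℤ)) + P.r₀ * P.q * P.cs * P.b)
        / (P.bd * P.q ^ (2 * k) + P.r₀ * P.q⁻¹ * P.cs * P.b)))

/-- The coefficient `k_N^{a,b,c}` as a function of `q`, `r₀`, `n = 2s` and of the pairs
`(bᵃ, cᵃ)`, `(bᵇ, cᵇ)`, `(bᶜ, cᶜ)`. -/
def kCoeff (q r₀ : ℂ) (n : ℕ) (ba ca bb cb bc cc : ℂ) (N : ℕ) : ℂ :=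
  (qPoch (-(bb * bc / ca * r₀ * q ^ (2 * n + 1))) (q ^ 2) N
      * qPoch (-(ba * cc / cb * r₀ * q)) (q ^ 2) N
      * qPoch (bb / cb) (q ^ 2) N * qPoch (q ^ (-(2 * n : ℤ))) (q ^ 2) N)
    / (qPoch (q ^ 2) (q ^ 2) N
      * qPoch (-(bb * bc / ba * r₀ * q)) (q ^ 2) N
      * qPoch (-(ca * cc / cb * r₀ * q ^ (1 - 2 * n : ℤ))) (q ^ 2) N
      * qPoch (bb / cb * q ^ (2 * n + 2)) (q ^ 2) N)
    * ((1 - bb / cb * q ^ (4 * N)) / ((ba / ca) ^ N * (1 - bb / cb)))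

/-- The coefficient `k_M^{.,◇,*}`. It is obtained from `k_M^{◇,.,*}` by the exchange of `(bd, cd)`
with `(b, c)` and of `bs q^{4s}` with `cs`. -/
def kDiamond (P : Params) (M : ℕ) : ℂ :=
  kCoeff P.q P.r₀ P.n P.b P.c P.bd P.cd
    (P.cs * P.q ^ (-(2 * P.n : ℤ))) (P.bs * P.q ^ (2 * P.n)) M

/-- `∏_j (U_j - r₀ θ◇_M / (q + q⁻¹))`. -/
def rootProd (P : Params) {N : ℕ} (U : Fin N → ℂ) (M : ℕ) : ℂ :=
  ∏ j, (U j - P.r₀ / (P.q + P.q⁻¹) * eigval P.q P.bd P.cd M)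

end BetheRacah

end

open BetheRacah

namespace BetheRacah

open Polynomial (X C)
open scoped Polynomial Topology

/-! Write J(z) = z + z⁻¹ (`joukowski`), t = q² and z_M = r₀ b◇ q^{2M} (`Params.gridPt`). Then J(z_M)
= r₀ θ◇_M, so up to a constant factor `rootProd` is the value at J(z_M) of the monic polynomial Q
with roots J(q u_j²) (`bethePoly`). The theorem compares the restrictions of two such polynomials to
the grid z_0, …, z_n, n = 2s.

Homogeneous side. Askey-Wilson operators preserve degree (`exists_isAWImage`). The Bethe equations
say that the image of Q_h under the operator with numerator `numHom` vanishes at the N roots of Q_h,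
so Q_h is an eigenvector (`isAWImage_of_isHomRoots`).

Inhomogeneous side. Let D be the operator with numerator `numInhom`, and X multiplication by the
variable. A q-commutator of D and X raises the degree of Q_i to n + 1, and the inhomogeneous term, a
multiple of ψ_{n+1} = ∏_{M≤n} (X - J(z_M)), removes the top coefficient. What is left has degree at
most n and vanishes at the n Bethe roots, so it is a multiple of Q_i (`inhomTQ_of_isInhomRoots`). As
ψ_{n+1} vanishes on the grid, Q_i restricted to the grid is an eigenvector of the q-commutator
(`qComm_of_isInhomRoots`).

Comparison. On the grid both operators are tridiagonal. After an affine normalization of the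
homogeneous one, their diagonals agree for M < n (`diag_eq`), and conjugation by h_M matches the
off-diagonals (`upCoeff_mul_hCoeff`, `downCoeff_mul_hCoeff`). For equal eigenvalues θ*_N, Q_h / h_M
and Q_i solve one three-term recurrence, hence are proportional (`grid_proportional`).

Denominators. D is symmetric for the weights k_M (`kDiamond_balance`), and the constant 1 is cyclic
for the transposed q-commutator, since each application raises the degree by exactly one. A vector v
with ∑ k_M v_M = 0 would thus pair to zero with all polynomials, forcing v_0 = 0 and then v = 0
(`eq_zero_of_sum_kDiamond`, `grid_eq_zero`).

Uniqueness. Two monic polynomials of degree n that are proportional at n + 1 distinct points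
coincide. -/

/-- The map `z ↦ z + z⁻¹`. -/
noncomputable def joukowski (z : ℂ) : ℂ := z + z⁻¹

lemma joukowski_inv (z : ℂ) : joukowski z⁻¹ = joukowski z := by
  simp [joukowski, add_comm]

/-! ### Divided differences of polynomials. -/

/-- The divided difference `(p(x) - p(y)) / (x - y)` of a polynomial, defined also for `x = y`. -/
noncomputable def divDiff (p : ℂ[X]) (x y : ℂ) : ℂ := (p /ₘ (X - C y)).eval x

lemma sub_mul_divDiff (p : ℂ[X]) (x y : ℂ) :
    (x - y) * divDiff p x y = p.eval x - p.eval y := by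
  have h := congrArg (Polynomial.eval x) (Polynomial.modByMonic_add_div p (X - C y))
  rw [Polynomial.modByMonic_X_sub_C_eq_C_eval] at h
  simp only [Polynomial.eval_add, Polynomial.eval_C, Polynomial.eval_mul, Polynomial.eval_sub,
    Polynomial.eval_X] at h
  rw [divDiff, ← h]; ring

lemma divDiff_sub_mul_add (p : ℂ[X]) (v x y : ℂ) :
    divDiff ((X - C y) * p + C v) x y = p.eval x := by
  rw [divDiff, (Polynomial.div_modByMonic_unique p (C v) (Polynomial.monic_X_sub_C y)
    ⟨add_comm _ _, _⟩).1]
  rw [Polynomial.degree_X_sub_C]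
  exact lt_of_le_of_lt Polynomial.degree_C_le (by norm_num)

lemma exists_eq_sub_mul_add (p : ℂ[X]) (y : ℂ) : ∃ g : ℂ[X], p = (X - C y) * g + C (p.eval y) :=
  ⟨p /ₘ (X - C y), by
    rw [← Polynomial.modByMonic_X_sub_C_eq_C_eval, add_comm, Polynomial.modByMonic_add_div]⟩

lemma divDiff_X_sub_C_mul (p : ℂ[X]) (x y : ℂ) : divDiff ((X - C y) * p) x y = p.eval x := by
  simpa using divDiff_sub_mul_add p 0 x y

lemma divDiff_C (a x y : ℂ) : divDiff (C a) x y = 0 := by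
  simpa using divDiff_sub_mul_add 0 a x y

lemma divDiff_add (p r : ℂ[X]) (x y : ℂ) : divDiff (p + r) x y = divDiff p x y + divDiff r x y := by
  obtain ⟨g, hg⟩ := exists_eq_sub_mul_add p y
  obtain ⟨k, hk⟩ := exists_eq_sub_mul_add r y
  have h : p + r = (X - C y) * (g + k) + C (p.eval y + r.eval y) := by
    conv_lhs => rw [hg, hk]
    rw [C.map_add]; ring
  rw [h, hg, hk]
  simp only [divDiff_sub_mul_add, Polynomial.eval_add]

lemma divDiff_C_mul (a : ℂ) (p : ℂ[X]) (x y : ℂ) : divDiff (C a * p) x y = a * divDiff p x y := by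
  obtain ⟨g, hg⟩ := exists_eq_sub_mul_add p y
  have h : C a * p = (X - C y) * (C a * g) + C (a * p.eval y) := by
    conv_lhs => rw [hg]
    rw [C.map_mul]; ring
  rw [h, hg]
  simp only [divDiff_sub_mul_add, Polynomial.eval_mul, Polynomial.eval_C]

lemma divDiff_X_mul (p : ℂ[X]) (x y : ℂ) :
    divDiff (X * p) x y = x * divDiff p x y + p.eval y := by
  obtain ⟨g, hg⟩ := exists_eq_sub_mul_add p y
  have h : X * p = (X - C y) * (X * g + C (p.eval y)) + C (y * p.eval y) := by
    conv_lhs => rw [hg]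
    rw [C.map_mul]; ring
  conv_lhs => rw [h]
  conv_rhs => rw [hg]
  rw [divDiff_sub_mul_add, divDiff_sub_mul_add]
  simp

/-- Joint continuity, including the diagonal, is what lets identities for Askey-Wilson operators
pass from generic z to the points t z² = 1. -/
lemma continuous_divDiff (p : ℂ[X]) : Continuous fun w : ℂ × ℂ => divDiff p w.1 w.2 := by
  induction p using Polynomial.induction_on with
  | C a => simpa [divDiff_C] using continuous_const
  | add p r hp hr => simp only [divDiff_add]; exact hp.add hr
  | monomial k a h =>
    have : C a * X ^ (k + 1) = X * (C a * X ^ k) := by ring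
    simp only [this, divDiff_X_mul]
    refine (continuous_fst.mul h).add ?_
    exact (Polynomial.continuous _).comp continuous_snd

/-! ### Askey-Wilson operators. -/

/-- The numerator `(1 - az)(1 - bz)(1 - cz)(1 - dz)` of the Askey-Wilson operator. -/
def awNum (a b c d z : ℂ) : ℂ := (1 - a * z) * (1 - b * z) * (1 - c * z) * (1 - d * z)

/-- The upward half of the Askey-Wilson operator in base `t`, with numerator `N`. -/
noncomputable def halfOp (t : ℂ) (N : ℂ → ℂ) (p : ℂ[X]) (z : ℂ) : ℂ :=
  -(1 - t⁻¹) * (N z / (z * (1 - z ^ 2))) * divDiff p (joukowski (t * z)) (joukowski z)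

/-- The Askey-Wilson operator in base `t`, with numerator `N`. -/
noncomputable def awOp (t : ℂ) (N : ℂ → ℂ) (p : ℂ[X]) (z : ℂ) : ℂ :=
  halfOp t N p z + halfOp t N p z⁻¹

lemma awOp_add (t : ℂ) (N : ℂ → ℂ) (p r : ℂ[X]) (z : ℂ) :
    awOp t N (p + r) z = awOp t N p z + awOp t N r z := by
  simp only [awOp, halfOp, divDiff_add]; ring

lemma awOp_C_mul (t : ℂ) (N : ℂ → ℂ) (a : ℂ) (p : ℂ[X]) (z : ℂ) :
    awOp t N (C a * p) z = a * awOp t N p z := by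
  simp only [awOp, halfOp, divDiff_C_mul]; ring

lemma awOp_C (t : ℂ) (N : ℂ → ℂ) (a z : ℂ) : awOp t N (C a) z = 0 := by
  simp [awOp, halfOp, divDiff_C]

lemma inv_sq_ne_one {z : ℂ} (h : z ^ 2 ≠ 1) : z⁻¹ ^ 2 ≠ 1 := by
  rw [inv_pow]; simpa using h

lemma joukowski_mul_sub {t z : ℂ} (ht : t ≠ 0) (hz : z ≠ 0) :
    joukowski (t * z) - joukowski z = -(1 - t⁻¹) * (1 - t * z ^ 2) / z := by
  simp only [joukowski]; field_simp; ring

/-- The usual form has an apparent pole at t z² = 1, cancelled by the factor 1 - t z² of J(tz) -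
J(z). The divided difference keeps the operator meaningful there, which matters because
admissibility does not exclude Bethe roots with t (q u²)² = 1. -/
lemma halfOp_eq {t z : ℂ} (ht : t ≠ 0) (hz : z ≠ 0) (h2 : 1 - t * z ^ 2 ≠ 0)
    (N : ℂ → ℂ) (p : ℂ[X]) :
    halfOp t N p z = N z / ((1 - z ^ 2) * (1 - t * z ^ 2))
      * (p.eval (joukowski (t * z)) - p.eval (joukowski z)) := by
  rw [← sub_mul_divDiff, joukowski_mul_sub ht hz, halfOp]
  by_cases h : 1 - z ^ 2 = 0
  · simp [h]
  · field_simp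

lemma halfOp_eq_of_or {t z : ℂ} (ht : t ≠ 0) (hz : z ≠ 0) {N : ℂ → ℂ}
    (h2 : 1 - t * z ^ 2 ≠ 0 ∨ N z = 0) (p : ℂ[X]) :
    halfOp t N p z = N z / ((1 - z ^ 2) * (1 - t * z ^ 2))
      * (p.eval (joukowski (t * z)) - p.eval (joukowski z)) := by
  rcases h2 with h2 | h2
  · exact halfOp_eq ht hz h2 N p
  · simp [halfOp, h2]

lemma continuousAt_halfOp {t z : ℂ} (ht : t ≠ 0) (hz : z ≠ 0) (h2 : z ^ 2 ≠ 1)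
    {N : ℂ → ℂ} (hN : Continuous N) (p : ℂ[X]) : ContinuousAt (halfOp t N p) z := by
  have h3 : 1 - z ^ 2 ≠ 0 := sub_ne_zero.2 (Ne.symm h2)
  have hJ : ContinuousAt (fun w => (joukowski (t * w), joukowski w)) z := by
    unfold joukowski
    have := mul_ne_zero ht hz
    fun_prop (disch := assumption)
  have h1 : ContinuousAt (fun w => divDiff p (joukowski (t * w)) (joukowski w)) z :=
    ContinuousAt.comp (f := fun w => (joukowski (t * w), joukowski w))
      (continuous_divDiff p).continuousAt hJ
  have h4 : ContinuousAt (fun w => N w / (w * (1 - w ^ 2))) z :=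
    hN.continuousAt.div (by fun_prop) (mul_ne_zero hz h3)
  unfold halfOp
  exact (continuousAt_const.mul h4).mul h1

lemma continuousAt_awOp {t z : ℂ} (ht : t ≠ 0) (hz : z ≠ 0) (h2 : z ^ 2 ≠ 1)
    {N : ℂ → ℂ} (hN : Continuous N) (p : ℂ[X]) : ContinuousAt (awOp t N p) z := by
  refine (continuousAt_halfOp ht hz h2 hN p).add ?_
  exact ContinuousAt.comp (f := fun w : ℂ => w⁻¹)
    (continuousAt_halfOp ht (inv_ne_zero hz) (inv_sq_ne_one h2) hN p)
    (continuousAt_inv₀ hz)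

/-! ### Triangular action on the basis ψ_k. -/

/-- The basis `ψ_k = ∏_{i<k} (X - J(a tⁱ))`. -/
noncomputable def psi (t a : ℂ) (k : ℕ) : ℂ[X] :=
  ∏ i ∈ range k, (X - C (joukowski (a * t ^ i)))

lemma psi_succ (t a : ℂ) (k : ℕ) :
    psi t a (k + 1) = psi t a k * (X - C (joukowski (a * t ^ k))) := prod_range_succ _ _

lemma monic_psi (t a : ℂ) (k : ℕ) : (psi t a k).Monic :=
  Polynomial.monic_prod_of_monic _ _ fun _ _ => Polynomial.monic_X_sub_C _

lemma natDegree_psi (t a : ℂ) (k : ℕ) : (psi t a k).natDegree = k := by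
  rw [psi, Polynomial.natDegree_prod_of_monic _ _ fun _ _ => Polynomial.monic_X_sub_C _]
  simp

lemma coeff_psi (t a : ℂ) (k : ℕ) : (psi t a k).coeff k = 1 := by
  have := (monic_psi t a k).coeff_natDegree
  rwa [natDegree_psi] at this

/-- Since J(z) - J(c) = -c⁻¹ (1 - cz)(1 - c/z), the shift z ↦ tz moves the factors of ψ along the
progression a tⁱ, and only the factors at its ends change. The multiplier 1 - az is supplied by the
numerator of the operator. -/
lemma psi_shift {t a z : ℂ} (ht : t ≠ 0) (ha : a ≠ 0) (hz : z ≠ 0) (k : ℕ) :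
    (1 - a * z) * (psi t a (k + 1)).eval (joukowski (t * z))
      = -(a * t ^ k)⁻¹ * (1 - a * t ^ (k + 1) * z) * (1 - a / (t * z)) * (1 - a * t ^ k * z)
        * (psi t a k).eval (joukowski z) := by
  induction k with
  | zero => simp [psi, joukowski]; field_simp; ring
  | succ k ih =>
    rw [psi_succ, Polynomial.eval_mul, ← mul_assoc, ih, psi_succ t a k, Polynomial.eval_mul]
    have htk := pow_ne_zero k ht
    simp only [joukowski, Polynomial.eval_sub, Polynomial.eval_X, Polynomial.eval_C, pow_succ]
    generalize t ^ k = T at *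
    generalize (psi t a k).eval (z + z⁻¹) = P
    field_simp
    ring

/-- The eigenvalue of the Askey-Wilson operator in degree `k`. -/
noncomputable def awEig (t ρ : ℂ) (k : ℕ) : ℂ := (t ^ k)⁻¹ + ρ * t ^ k - 1 - ρ

/-- The subleading coefficient of the Askey-Wilson operator in the basis `ψ`. -/
noncomputable def awSub (t a b c d : ℂ) (k : ℕ) : ℂ :=
  (1 - t ^ (k + 1)) * (1 - a * b * t ^ k) * (1 - a * c * t ^ k) * (1 - a * d * t ^ k)
    / (t ^ (k + 1) * (a * t ^ k))

lemma awOp_psi_succ_of_generic {t a b c d ρ z : ℂ} (ht : t ≠ 0) (ha : a ≠ 0)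
    (hρ : a * b * c * d = ρ * t)
    (hz : z ≠ 0) (h2 : z ^ 2 ≠ 1) (h3 : 1 - t * z ^ 2 ≠ 0) (h4 : 1 - t * z⁻¹ ^ 2 ≠ 0) (k : ℕ) :
    awOp t (awNum a b c d) (psi t a (k + 1)) z
      = awEig t ρ (k + 1) * (psi t a (k + 1)).eval (joukowski z)
        + awSub t a b c d k * (psi t a k).eval (joukowski z) := by
  have e1 := psi_shift ht ha hz k
  have e2 := psi_shift ht ha (inv_ne_zero hz) k
  rw [awOp, halfOp_eq ht hz h3, halfOp_eq ht (inv_ne_zero hz) h4, awNum, awNum]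
  rw [joukowski_inv] at *
  have h5 : ∀ w A B : ℂ, (1 - a * w) * (1 - b * w) * (1 - c * w) * (1 - d * w) /
      ((1 - w ^ 2) * (1 - t * w ^ 2)) * (A - B) =
      (1 - b * w) * (1 - c * w) * (1 - d * w) /
      ((1 - w ^ 2) * (1 - t * w ^ 2)) * ((1 - a * w) * A - (1 - a * w) * B) := by
    intro w A B; ring
  rw [h5, h5, e1, e2]
  have e3 : (psi t a (k + 1)).eval (joukowski z)
      = (psi t a k).eval (joukowski z) * (z + z⁻¹ - (a * t ^ k + (a * t ^ k)⁻¹)) := by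
    rw [psi_succ, Polynomial.eval_mul]; simp [joukowski]
  rw [e3]
  generalize (psi t a k).eval (joukowski z) = P
  have htk := pow_ne_zero k ht
  have hρ' : ρ = a * b * c * d / t := by field_simp; rw [hρ]
  rw [hρ']
  rw [awEig, awSub, pow_succ t k]
  generalize t ^ k = T at *
  have h6 : 1 - z ^ 2 ≠ 0 := sub_ne_zero.2 (Ne.symm h2)
  have h7 : z ^ 2 - t ≠ 0 := by
    intro h; apply h4; field_simp; linear_combination h
  have h8 : 1 - z⁻¹ ^ 2 = -(1 - z ^ 2) / z ^ 2 := by field_simp; ring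
  have h9 : 1 - t * z⁻¹ ^ 2 = (z ^ 2 - t) / z ^ 2 := by field_simp
  have h10 : 1 - z ^ 2 * t ≠ 0 := by rwa [mul_comm]
  rw [h8, h9]
  field_simp
  ring

lemma eventually_nhdsNE_generic {t : ℂ} (ht : t ≠ 0) (z₀ : ℂ) :
    ∀ᶠ z in 𝓝[≠] z₀, z ≠ 0 ∧ z ^ 2 ≠ 1 ∧ 1 - t * z ^ 2 ≠ 0 ∧ 1 - t * z⁻¹ ^ 2 ≠ 0 := by
  have key : ∀ p : ℂ[X], p ≠ 0 → ∀ᶠ z in 𝓝[≠] z₀, p.eval z ≠ 0 := by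
    intro p hp
    have hfin : Set.Finite {z | p.IsRoot z} := Polynomial.finite_setOfPred_isRoot hp
    exact nhdsNE_le_cofinite z₀ hfin.compl_mem_cofinite
  have hX : ∀ a b : ℂ, b ≠ 0 → (C a + C b * X ^ 2 : ℂ[X]) ≠ 0 := by
    intro a b hb h
    have := congrArg (fun p => Polynomial.coeff p 2) h
    simp [hb] at this
  filter_upwards [key X Polynomial.X_ne_zero, key _ (hX (-1) 1 one_ne_zero),
    key _ (hX 1 (-t) (neg_ne_zero.2 ht)), key _ (hX (-t) 1 one_ne_zero)] with z h1 h2 h3 h4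
  simp only [Polynomial.eval_X] at h1
  refine ⟨h1, fun h => h2 (by simp [h]), fun h => h3 ?_, fun h => h4 ?_⟩
  · simp only [Polynomial.eval_add, Polynomial.eval_mul, Polynomial.eval_C, Polynomial.eval_pow,
      Polynomial.eval_X]
    linear_combination h
  · field_simp at h
    simp only [Polynomial.eval_add, Polynomial.eval_mul, Polynomial.eval_C, Polynomial.eval_pow,
      Polynomial.eval_X]
    linear_combination h

lemma continuous_awNum (a b c d : ℂ) : Continuous (awNum a b c d) := by
  unfold awNum; fun_prop

lemma continuousAt_eval_joukowski (p : ℂ[X]) {z : ℂ} (hz : z ≠ 0) :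
    ContinuousAt (fun w => p.eval (joukowski w)) z := by
  refine ContinuousAt.comp (f := joukowski) (Polynomial.continuous _).continuousAt ?_
  unfold joukowski
  fun_prop (disch := assumption)

/-- Both sides are continuous away from z = 0 and z² = 1, and they agree on a punctured
neighbourhood by the generic case. -/
lemma awOp_psi_succ {t a b c d ρ z : ℂ} (ht : t ≠ 0) (ha : a ≠ 0)
    (hρ : a * b * c * d = ρ * t) (hz : z ≠ 0) (h2 : z ^ 2 ≠ 1) (k : ℕ) :
    awOp t (awNum a b c d) (psi t a (k + 1)) z
      = (C (awEig t ρ (k + 1)) * psi t a (k + 1) + C (awSub t a b c d k) * psi t a k).eval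
          (joukowski z) := by
  have h := (continuousAt_awOp ht hz h2 (continuous_awNum a b c d)
    (psi t a (k + 1))).eventuallyEq_nhds_iff_eventuallyEq_nhdsNE
      (continuousAt_eval_joukowski (C (awEig t ρ (k + 1)) * psi t a (k + 1)
        + C (awSub t a b c d k) * psi t a k) hz)
  refine (h.1 ?_).eq_of_nhds
  filter_upwards [eventually_nhdsNE_generic ht z] with w hw
  rw [awOp_psi_succ_of_generic ht ha hρ hw.1 hw.2.1 hw.2.2.1 hw.2.2.2]
  simp

/-- `r` is the image of `p` under the Askey-Wilson operator. -/
def IsAWImage (t : ℂ) (N : ℂ → ℂ) (p r : ℂ[X]) : Prop :=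
  ∀ z : ℂ, z ≠ 0 → z ^ 2 ≠ 1 → awOp t N p z = r.eval (joukowski z)

lemma IsAWImage.add {t : ℂ} {N : ℂ → ℂ} {p r p' r' : ℂ[X]} (h : IsAWImage t N p r)
    (h' : IsAWImage t N p' r') : IsAWImage t N (p + p') (r + r') := by
  intro z hz h2
  rw [awOp_add, h z hz h2, h' z hz h2, Polynomial.eval_add]

lemma IsAWImage.C_mul {t : ℂ} {N : ℂ → ℂ} {p r : ℂ[X]} (h : IsAWImage t N p r) (a : ℂ) :
    IsAWImage t N (C a * p) (C a * r) := by
  intro z hz h2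
  rw [awOp_C_mul, h z hz h2, Polynomial.eval_mul, Polynomial.eval_C]

lemma isAWImage_psi_succ {t a b c d ρ : ℂ} (ht : t ≠ 0) (ha : a ≠ 0)
    (hρ : a * b * c * d = ρ * t) (k : ℕ) :
    IsAWImage t (awNum a b c d) (psi t a (k + 1))
      (C (awEig t ρ (k + 1)) * psi t a (k + 1) + C (awSub t a b c d k) * psi t a k) :=
  fun _ hz h2 => awOp_psi_succ ht ha hρ hz h2 k

lemma natDegree_sub_C_mul_psi_le (t a : ℂ) {d : ℕ} {p : ℂ[X]} (hp : p.natDegree ≤ d + 1) :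
    (p - C (p.coeff (d + 1)) * psi t a (d + 1)).natDegree ≤ d := by
  rw [Polynomial.natDegree_le_iff_coeff_eq_zero]
  intro m hm
  rw [Polynomial.coeff_sub, Polynomial.coeff_C_mul]
  rcases eq_or_lt_of_le (Nat.succ_le_of_lt hm) with h | h
  · rw [← h, Nat.succ_eq_add_one, coeff_psi]; ring
  · have h' : p.natDegree < m := lt_of_le_of_lt hp h
    have h'' : (psi t a (d + 1)).natDegree < m := by rw [natDegree_psi]; exact h
    rw [Polynomial.coeff_eq_zero_of_natDegree_lt h', Polynomial.coeff_eq_zero_of_natDegree_lt h'']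
    ring

/-- The operator is lower triangular in the basis ψ_k with diagonal `awEig`, so leading terms can be
stripped off one at a time. -/
lemma exists_isAWImage {t a b c d ρ : ℂ} (ht : t ≠ 0) (ha : a ≠ 0)
    (hρ : a * b * c * d = ρ * t) (k : ℕ) (p : ℂ[X]) (hp : p.natDegree ≤ k) :
    ∃ r : ℂ[X], r.natDegree ≤ k ∧ r.coeff k = awEig t ρ k * p.coeff k ∧
      IsAWImage t (awNum a b c d) p r := by
  induction k generalizing p with
  | zero =>
    refine ⟨0, by simp, by simp [awEig], fun z _ _ => ?_⟩
    rw [Polynomial.eq_C_of_natDegree_le_zero hp, awOp_C, Polynomial.eval_zero]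
  | succ k ih =>
    obtain ⟨r, hr1, _, hr3⟩ := ih _ (natDegree_sub_C_mul_psi_le t a hp)
    set l := p.coeff (k + 1)
    refine ⟨C l * (C (awEig t ρ (k + 1)) * psi t a (k + 1) + C (awSub t a b c d k) * psi t a k)
      + r, ?_, ?_, ?_⟩
    · refine Polynomial.natDegree_add_le_of_degree_le ?_ (hr1.trans (Nat.le_succ k))
      refine (Polynomial.natDegree_C_mul_le _ _).trans
        (Polynomial.natDegree_add_le_of_degree_le ?_ ?_)
      · exact (Polynomial.natDegree_C_mul_le _ _).trans (natDegree_psi t a _).le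
      · exact (Polynomial.natDegree_C_mul_le _ _).trans
          ((natDegree_psi t a _).le.trans (Nat.le_succ k))
    · rw [Polynomial.coeff_add, Polynomial.coeff_C_mul, Polynomial.coeff_add,
        Polynomial.coeff_C_mul, Polynomial.coeff_C_mul, coeff_psi,
        Polynomial.coeff_eq_zero_of_natDegree_lt (lt_of_le_of_lt hr1 (Nat.lt_succ_self k)),
        Polynomial.coeff_eq_zero_of_natDegree_lt
          (lt_of_le_of_lt (natDegree_psi t a k).le (Nat.lt_succ_self k))]
      ring
    · have := ((isAWImage_psi_succ ht ha hρ k).C_mul l).add hr3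
      rwa [add_sub_cancel] at this

/-! ### Three-term recurrences and symmetric difference operators on a finite grid. -/

/-- A solution of a three-term recurrence on `0, …, n` with vanishing first entry is zero. -/
lemma three_term_eq_zero {n : ℕ} {α β γ v : ℕ → ℂ} {θ : ℂ} (hα : ∀ M < n, α M ≠ 0)
    (hγ : γ 0 = 0)
    (hv : ∀ M < n, α M * v (M + 1) + β M * v M + γ M * v (M - 1) = θ * v M) (h0 : v 0 = 0) :
    ∀ M ≤ n, v M = 0 := by
  intro M
  induction M using Nat.strong_induction_on with
  | _ M ih =>
    intro hM
    rcases M with _ | M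
    · exact h0
    have hM' : M < n := hM
    have h1 := ih M (Nat.lt_succ_self M) hM'.le
    have h2 : γ M * v (M - 1) = 0 := by
      rcases M with _ | M
      · rw [hγ]; ring
      · rw [Nat.add_sub_cancel, ih M (by omega) (by omega)]; ring
    have h3 := hv M hM'
    rw [h1, h2] at h3
    simpa [hα M hM'] using h3

/-- Solutions of a three-term recurrence on `0, …, n` are determined by their first entry. -/
lemma three_term_proportional {n : ℕ} {α β γ v w : ℕ → ℂ} {θ : ℂ} (hα : ∀ M < n, α M ≠ 0)
    (hγ : γ 0 = 0)
    (hv : ∀ M < n, α M * v (M + 1) + β M * v M + γ M * v (M - 1) = θ * v M)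
    (hw : ∀ M < n, α M * w (M + 1) + β M * w M + γ M * w (M - 1) = θ * w M) :
    ∀ M ≤ n, w 0 * v M = v 0 * w M := by
  intro M hM
  refine sub_eq_zero.1 (three_term_eq_zero (β := β) (θ := θ)
    (v := fun M => w 0 * v M - v 0 * w M) hα hγ
    (fun M hM => ?_) (by ring) M hM)
  linear_combination w 0 * hv M hM - v 0 * hw M hM

/-- The birth-death type difference operator with rates `U`, `D`. -/
def gridOp (U D f : ℕ → ℂ) (M : ℕ) : ℂ :=
  U M * (f (M + 1) - f M) + D M * (f (M - 1) - f M)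

/-- Summation by parts. The boundary term is kept so that the induction on n closes; it disappears
when `U n = 0`, and the remaining sum is symmetric in f and g. -/
lemma sum_gridOp {n : ℕ} {U D k : ℕ → ℂ} (hD : D 0 = 0)
    (hk : ∀ M < n, k (M + 1) * D (M + 1) = k M * U M) (f g : ℕ → ℂ) :
    ∑ M ∈ range (n + 1), k M * gridOp U D f M * g M
      = -∑ M ∈ range n, k M * U M * (f (M + 1) - f M) * (g (M + 1) - g M)
        + k n * U n * (f (n + 1) - f n) * g n := by
  induction n with
  | zero => simp [gridOp, hD, mul_assoc]
  | succ n ih =>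
    rw [sum_range_succ, ih fun M hM => hk M (hM.trans (Nat.lt_succ_self n)), sum_range_succ _ n]
    have := hk n (Nat.lt_succ_self n)
    simp only [gridOp, Nat.add_sub_cancel]
    linear_combination (f n - f (n + 1)) * g (n + 1) * this

lemma sum_gridOp_comm {n : ℕ} {U D k : ℕ → ℂ} (hU : U n = 0) (hD : D 0 = 0)
    (hk : ∀ M < n, k (M + 1) * D (M + 1) = k M * U M) (f g : ℕ → ℂ) :
    ∑ M ∈ range (n + 1), k M * gridOp U D f M * g M
      = ∑ M ∈ range (n + 1), k M * gridOp U D g M * f M := by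
  rw [sum_gridOp hD hk, sum_gridOp hD hk, hU]
  congr 1
  · exact congrArg _ (sum_congr rfl fun M _ => by ring)
  · ring

lemma exists_eval_ne_zero_eq_zero {n : ℕ} {x : ℕ → ℂ}
    (hx : ∀ M, 0 < M → M ≤ n → x M ≠ x 0) :
    ∃ g : ℂ[X], g.eval (x 0) ≠ 0 ∧ ∀ M, 0 < M → M ≤ n → g.eval (x M) = 0 := by
  refine ⟨∏ i ∈ range n, (X - C (x (i + 1))), ?_, fun M h0 hM => ?_⟩
  · rw [Polynomial.eval_prod, prod_ne_zero_iff]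
    intro i hi
    rw [mem_range] at hi
    simpa [sub_eq_zero] using (hx (i + 1) (by omega) (by omega)).symm
  · rw [Polynomial.eval_prod]
    refine prod_eq_zero (mem_range.2 (by omega : M - 1 < n)) ?_
    simp [Nat.sub_add_cancel h0]

/-- The eigenvectors of `q D X - q⁻¹ X D` do not pair to zero with the weights `k` for which the
degree preserving operator `D` is self-adjoint. -/
lemma eval_eq_zero_of_sum_eq_zero {n : ℕ} {x U D k : ℕ → ℂ} {lam : ℕ → ℂ} {q m c₀ B : ℂ}
    (hx : ∀ M, 0 < M → M ≤ n → x M ≠ x 0)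
    (hU : U n = 0) (hD : D 0 = 0) (hk : ∀ M < n, k (M + 1) * D (M + 1) = k M * U M)
    (hk0 : k 0 ≠ 0) (hc₀ : c₀ ≠ 0)
    (himage : ∀ (d : ℕ) (p : ℂ[X]), p.natDegree ≤ d → ∃ r : ℂ[X], r.natDegree ≤ d ∧
      r.coeff d = lam d * p.coeff d ∧
      ∀ M ≤ n, gridOp U D (fun i => p.eval (x i)) M = r.eval (x M))
    (hlam : ∀ d, q * lam d - q⁻¹ * lam (d + 1) + m ≠ 0) {v : ℕ → ℂ}
    (hv : ∀ M ≤ n, c₀ * (q * gridOp U D (fun i => x i * v i) M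
      - q⁻¹ * (x M * gridOp U D v M) + m * x M * v M) = B * v M)
    (hsum : ∑ M ∈ range (n + 1), k M * v M = 0) : v 0 = 0 := by
  -- The orthogonality of v to the constants propagates to every polynomial, by induction on the
  -- degree.
  have key : ∀ (d : ℕ) (g : ℂ[X]), g.natDegree ≤ d →
      ∑ M ∈ range (n + 1), k M * g.eval (x M) * v M = 0 := by
    intro d
    induction d with
    | zero =>
      intro g hg
      rw [Polynomial.eq_C_of_natDegree_le_zero hg]
      simp only [Polynomial.eval_C]
      have : ∀ M, k M * g.coeff 0 * v M = g.coeff 0 * (k M * v M) := fun M => by ring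
      simp only [this, ← mul_sum, hsum, mul_zero]
    | succ d ih =>
      intro g hg
      obtain ⟨r, hr1, hr2, hr3⟩ := himage d (X ^ d) (Polynomial.natDegree_X_pow_le d)
      obtain ⟨s, hs1, hs2, hs3⟩ := himage (d + 1) (X ^ (d + 1)) (Polynomial.natDegree_X_pow_le _)
      set e := q * lam d - q⁻¹ * lam (d + 1) + m with he
      -- On the grid, G is the transposed q-commutator applied to X^d: transposition exchanges D X
      -- with X D. As v is an eigenvector, pairing it with G reduces to pairing it with X^d.
      set G : ℂ[X] := C q * (X * r) - C q⁻¹ * s + C m * X ^ (d + 1) with hG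
      have hGsum : ∑ M ∈ range (n + 1), k M * G.eval (x M) * v M = 0 := by
        have h1 := sum_gridOp_comm hU hD hk (fun i => x i * v i) (fun i => (X ^ d : ℂ[X]).eval (x i))
        have h2 := sum_gridOp_comm hU hD hk v (fun i => (X ^ (d + 1) : ℂ[X]).eval (x i))
        have h3 : ∑ M ∈ range (n + 1), (c₀ * (q * gridOp U D (fun i => x i * v i) M
            - q⁻¹ * (x M * gridOp U D v M) + m * x M * v M) - B * v M) * (k M * x M ^ d) = 0 := by
          refine sum_eq_zero fun M hM => ?_
          rw [hv M (Nat.lt_succ_iff.1 (mem_range.1 hM))]; ring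
        have h4 := ih (X ^ d) (Polynomial.natDegree_X_pow_le d)
        have h5 : c₀ * ∑ M ∈ range (n + 1), k M * G.eval (x M) * v M = 0 := by
          have h6 : ∑ M ∈ range (n + 1), k M * G.eval (x M) * v M
              = q * ∑ M ∈ range (n + 1),
                  k M * gridOp U D (fun i => (X ^ d : ℂ[X]).eval (x i)) M * (x M * v M)
                - q⁻¹ * ∑ M ∈ range (n + 1),
                  k M * gridOp U D (fun i => (X ^ (d + 1) : ℂ[X]).eval (x i)) M * v M
                + ∑ M ∈ range (n + 1), k M * (m * x M ^ (d + 1)) * v M := by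
            rw [mul_sum, mul_sum, ← sum_sub_distrib, ← sum_add_distrib]
            refine sum_congr rfl fun M hM => ?_
            have hM' := Nat.lt_succ_iff.1 (mem_range.1 hM)
            rw [hr3 M hM', hs3 M hM', hG]
            simp only [Polynomial.eval_add, Polynomial.eval_sub, Polynomial.eval_mul,
              Polynomial.eval_C, Polynomial.eval_X, Polynomial.eval_pow]
            ring
          rw [h6, ← h1, ← h2, ← h3, ← sub_zero (c₀ * _), ← mul_zero B, ← h4]
          simp only [mul_sum, ← sum_sub_distrib, ← sum_add_distrib]
          refine sum_congr rfl fun M _ => ?_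
          simp only [Polynomial.eval_X, Polynomial.eval_pow]
          ring
        exact (mul_eq_zero.1 h5).resolve_left hc₀
      have hGdeg : G.natDegree ≤ d + 1 := by
        refine Polynomial.natDegree_add_le_of_degree_le
          ((Polynomial.natDegree_sub_le_of_le ?_ ?_).trans (max_self _).le) ?_
        · refine (Polynomial.natDegree_C_mul_le _ _).trans (Polynomial.natDegree_mul_le.trans ?_)
          rw [Polynomial.natDegree_X]; omega
        · exact (Polynomial.natDegree_C_mul_le _ _).trans hs1
        · exact (Polynomial.natDegree_C_mul_le _ _).trans (Polynomial.natDegree_X_pow_le _)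
      have hGcoeff : G.coeff (d + 1) = e := by
        rw [hG, Polynomial.coeff_add, Polynomial.coeff_sub, Polynomial.coeff_C_mul,
          Polynomial.coeff_C_mul, Polynomial.coeff_C_mul, Polynomial.coeff_X_mul, hr2, hs2]
        simp [he]
      -- The leading coefficient e of G is nonzero, so subtracting a multiple of G lowers the degree
      -- of g.
      have h7 : (g - C (g.coeff (d + 1) / e) * G).natDegree ≤ d := by
        rw [Polynomial.natDegree_le_iff_coeff_eq_zero]
        intro j hj
        rw [Polynomial.coeff_sub, Polynomial.coeff_C_mul]
        rcases eq_or_lt_of_le (Nat.succ_le_of_lt hj) with h | h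
        · rw [← h, Nat.succ_eq_add_one, hGcoeff, div_mul_cancel₀ _ (hlam d), sub_self]
        · have h8 : g.natDegree < j := lt_of_le_of_lt hg h
          have h9 : G.natDegree < j := lt_of_le_of_lt hGdeg h
          rw [Polynomial.coeff_eq_zero_of_natDegree_lt h8,
            Polynomial.coeff_eq_zero_of_natDegree_lt h9]
          ring
      have h10 := ih _ h7
      rw [← h10, ← sub_zero (∑ M ∈ range (n + 1), k M * Polynomial.eval (x M) g * v M),
        ← mul_zero (g.coeff (d + 1) / e), ← hGsum, mul_sum, ← sum_sub_distrib]
      refine sum_congr rfl fun M _ => ?_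
      simp only [Polynomial.eval_sub, Polynomial.eval_mul, Polynomial.eval_C]
      ring
  -- A polynomial vanishing at all grid points except the zeroth one isolates `v 0`.
  obtain ⟨g, hg0, hg⟩ := exists_eval_ne_zero_eq_zero hx
  have h := key _ g le_rfl
  rw [sum_eq_single 0] at h
  · simpa [hk0, hg0] using h
  · intro M hM h0
    rw [hg M (Nat.pos_of_ne_zero h0) (Nat.lt_succ_iff.1 (mem_range.1 hM))]; ring
  · simp

/-! ### The grid and its nondegeneracy. -/

namespace Params

/-- The grid points `z_M = r₀ b◇ q^{2M}`. -/
noncomputable def gridPt (P : Params) (M : ℕ) : ℂ := P.r₀ * P.bd * (P.q ^ 2) ^ M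

/-- The numerator of the Askey-Wilson operator with eigenvectors the homogeneous Bethe states. -/
noncomputable def numHom (P : Params) : ℂ → ℂ :=
  awNum (P.r₀ * P.bd) (P.gridPt P.n)⁻¹ (-(P.q * (P.q ^ 2) ^ P.n * (P.b / P.cs)))
    (-(P.q * (P.bs / P.b)))

/-- The numerator of the Askey-Wilson operator which is self-adjoint for the weights `k_M`. -/
noncomputable def numInhom (P : Params) : ℂ → ℂ :=
  awNum (P.r₀ * P.bd) (P.gridPt P.n)⁻¹ (-(P.q * (P.q ^ 2) ^ P.n * (P.b / P.cs)))
    (-(P.q * (P.b / P.bs)))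

/-- The coefficient `N(z) / ((1 - z²) (1 - q² z²))` of an Askey-Wilson operator. -/
noncomputable def ratCoeff (P : Params) (N : ℂ → ℂ) (z : ℂ) : ℂ :=
  N z / ((1 - z ^ 2) * (1 - P.q ^ 2 * z ^ 2))

end Params

namespace Params.Valid

variable {P : Params}

lemma mul_bc (hP : P.Valid) : P.r₀ ^ 2 * (P.b * P.c) = 1 := by
  rw [← hP.r₀_eq, zpow_neg]; exact mul_inv_cancel₀ (pow_ne_zero 2 hP.r₀_ne)

lemma mul_bscs (hP : P.Valid) : P.r₀ ^ 2 * (P.bs * P.cs) = 1 := by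
  rw [← hP.r₀_eqs, zpow_neg]; exact mul_inv_cancel₀ (pow_ne_zero 2 hP.r₀_ne)

lemma mul_bdcd (hP : P.Valid) : P.r₀ ^ 2 * (P.bd * P.cd) = 1 := by
  rw [← hP.r₀_eqd, zpow_neg]; exact mul_inv_cancel₀ (pow_ne_zero 2 hP.r₀_ne)

lemma bc_eq_bscs (hP : P.Valid) : P.b * P.c = P.bs * P.cs := by rw [← hP.r₀_eq, hP.r₀_eqs]

lemma t_ne (hP : P.Valid) : P.q ^ 2 ≠ 0 := pow_ne_zero 2 hP.q_ne

lemma t_pow_ne_one (hP : P.Valid) {m : ℕ} (hm : 0 < m) : (P.q ^ 2) ^ m ≠ 1 := by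
  rw [← pow_mul]; exact hP.q_not_root _ (by omega)

lemma t_ne_one (hP : P.Valid) : P.q ^ 2 ≠ 1 := by simpa using hP.t_pow_ne_one one_pos

lemma t_add_one_ne (hP : P.Valid) : P.q ^ 2 + 1 ≠ 0 := by
  intro h
  apply hP.t_pow_ne_one two_pos
  linear_combination (P.q ^ 2 - 1) * h

lemma q_sub_inv_ne (hP : P.Valid) : P.q - P.q⁻¹ ≠ 0 := by
  intro h
  apply hP.t_ne_one
  have := hP.q_ne
  field_simp at h
  linear_combination h

lemma q_add_inv_ne (hP : P.Valid) : P.q + P.q⁻¹ ≠ 0 := by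
  intro h
  apply hP.t_add_one_ne
  have := hP.q_ne
  field_simp at h
  linear_combination h

lemma gridPt_ne (hP : P.Valid) (M : ℕ) : P.gridPt M ≠ 0 :=
  mul_ne_zero (mul_ne_zero hP.r₀_ne hP.bd_ne) (pow_ne_zero _ hP.t_ne)

lemma gridPt_zero (P : Params) : P.gridPt 0 = P.r₀ * P.bd := by simp [gridPt]

lemma gridPt_succ (P : Params) (M : ℕ) : P.gridPt (M + 1) = P.q ^ 2 * P.gridPt M := by
  simp only [gridPt, pow_succ]; ring

lemma inv_gridPt_zero (hP : P.Valid) : (P.r₀ * P.bd)⁻¹ = P.r₀ * P.cd := by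
  apply inv_eq_of_mul_eq_one_right; linear_combination hP.mul_bdcd

lemma joukowski_gridPt (hP : P.Valid) (M : ℕ) :
    joukowski (P.gridPt M) = P.r₀ * eigval P.q P.bd P.cd M := by
  have h1 : P.q ^ (-(2 * M : ℤ)) = ((P.q ^ 2) ^ M)⁻¹ := by
    rw [zpow_neg, ← pow_mul]; norm_cast
  rw [joukowski, eigval, h1, gridPt, mul_inv, hP.inv_gridPt_zero, ← pow_mul]; ring

/-- Here (r₀ b◇)² = b◇/c◇. The spectral condition on A◇ covers 0 < m < 2n, and the two extra
exclusions in `hk` cover m = 0 and m = 2n. -/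
lemma sq_mul_t_pow_ne_one (hP : P.Valid)
    (hk : P.bd / P.cd ≠ 1 ∧ P.bd / P.cd ≠ P.q ^ (-(4 * P.n : ℤ))) {m : ℕ} (hm : m ≤ 2 * P.n) :
    (P.r₀ * P.bd) ^ 2 * (P.q ^ 2) ^ m ≠ 1 := by
  have h1 : (P.r₀ * P.bd) ^ 2 = P.bd / P.cd := by
    rw [eq_div_iff hP.cd_ne]; linear_combination P.bd * hP.mul_bdcd
  rw [h1]
  intro h
  have h2 : P.bd / P.cd = P.q ^ (-(2 * m : ℤ)) := by
    rw [zpow_neg]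
    apply eq_inv_of_mul_eq_one_left
    rw [← h, ← pow_mul]
    norm_cast
  rcases Nat.eq_zero_or_pos m with h0 | h0
  · apply hk.1; rw [h2, h0]; simp
  rcases eq_or_lt_of_le hm with h3 | h3
  · apply hk.2; rw [h2, h3]; push_cast; ring_nf
  · exact hP.spec_d m h0 h3 h2

lemma gridPt_mul_ne_one (hP : P.Valid)
    (hk : P.bd / P.cd ≠ 1 ∧ P.bd / P.cd ≠ P.q ^ (-(4 * P.n : ℤ))) {i j : ℕ}
    (hm : i + j ≤ 2 * P.n) : P.gridPt i * P.gridPt j ≠ 1 := by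
  have h := hP.sq_mul_t_pow_ne_one hk hm
  intro h'
  apply h
  rw [← h', gridPt, gridPt, pow_add]; ring

lemma joukowski_gridPt_injective (hP : P.Valid)
    (hk : P.bd / P.cd ≠ 1 ∧ P.bd / P.cd ≠ P.q ^ (-(4 * P.n : ℤ))) {i j : ℕ}
    (hj : j ≤ P.n) (hij : i < j) :
    joukowski (P.gridPt i) ≠ joukowski (P.gridPt j) := by
  intro h
  have h1 := hP.gridPt_mul_ne_one hk (by omega : i + j ≤ 2 * P.n)
  have h2 := hP.gridPt_ne i
  have h3 := hP.gridPt_ne j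
  have h4 : (P.gridPt i - P.gridPt j) * (P.gridPt i * P.gridPt j - 1) = 0 := by
    unfold joukowski at h
    field_simp at h
    linear_combination h
  rcases mul_eq_zero.1 h4 with h5 | h5
  · obtain ⟨k, rfl⟩ := Nat.exists_eq_add_of_lt hij
    apply hP.t_pow_ne_one (Nat.succ_pos k)
    have h6 := mul_ne_zero (mul_ne_zero hP.r₀_ne hP.bd_ne) (pow_ne_zero i hP.t_ne)
    refine mul_left_cancel₀ h6 ?_
    simp only [gridPt] at h5
    rw [mul_one, mul_assoc, ← pow_add, Nat.succ_eq_add_one, ← add_assoc]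
    linear_combination -h5
  · exact h1 (sub_eq_zero.1 h5)

lemma div_eq (hP : P.Valid) : P.b / P.bs = P.cs / P.c := by
  rw [div_eq_div_iff hP.bs_ne hP.c_ne]; linear_combination hP.bc_eq_bscs

/-- In this lemma and the three that follow, a Leonard triple inequality is read as the nonvanishing
at z_M of a linear factor of the Askey-Wilson numerators, of h_M or of k_M. The index in the
inequality is M + 1 for the first and third, n - M for the second and fourth. -/
lemma one_add_ne₁ (hP : P.Valid) {M : ℕ} (hM : M < P.n) :
    1 + P.q * (P.b / P.bs) * P.gridPt M ≠ 0 := by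
  intro h
  apply hP.ne₁ (M + 1) (Nat.succ_pos M) hM
  have e : P.q ^ (-(2 * (M + 1 : ℕ) : ℤ) + 1) = (P.q * (P.q ^ 2) ^ M)⁻¹ := by
    rw [show (-(2 * (M + 1 : ℕ) : ℤ) + 1) = -((2 * M + 1 : ℕ) : ℤ) by push_cast; ring,
      zpow_neg, zpow_natCast, pow_succ, pow_mul, mul_comm]
  have hq := hP.q_ne
  have ht := pow_ne_zero M hP.t_ne
  have hc := hP.c_ne
  have h1 := hP.mul_bdcd
  rw [e]
  rw [hP.div_eq, gridPt] at h
  field_simp at h ⊢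
  linear_combination P.r₀ * P.cd * h - P.cs * P.q * (P.q ^ 2) ^ M * h1

lemma one_add_ne₂ (hP : P.Valid) {M : ℕ} (hM : M < P.n) :
    1 + P.q * (P.bs / P.b) * P.gridPt M ≠ 0 := by
  intro h
  apply hP.ne₂ (P.n - M) (by omega) (by omega)
  have e : P.q ^ (-(2 * (P.n - M : ℕ) : ℤ) + 1 + 2 * P.n) = P.q * (P.q ^ 2) ^ M := by
    rw [show (-(2 * (P.n - M : ℕ) : ℤ) + 1 + 2 * P.n) = ((2 * M + 1 : ℕ) : ℤ) by
      push_cast [Nat.cast_sub hM.le]; ring,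
      zpow_natCast, pow_succ, pow_mul, mul_comm]
  have hb := hP.b_ne
  rw [e]
  rw [gridPt] at h
  field_simp at h
  linear_combination h

lemma one_add_ne₃ (hP : P.Valid) {M : ℕ} (hM : M < P.n) :
    1 + P.q * (P.q ^ 2) ^ P.n * (P.b / P.cs) * P.gridPt M ≠ 0 := by
  intro h
  apply hP.ne₃ (M + 1) (Nat.succ_pos M) hM
  have e : P.q ^ ((2 * (M + 1 : ℕ) : ℤ) + 2 * P.n - 1)
      = P.q * (P.q ^ 2) ^ P.n * (P.q ^ 2) ^ M := by
    rw [show ((2 * (M + 1 : ℕ) : ℤ) + 2 * P.n - 1) = ((2 * P.n + 2 * M + 1 : ℕ) : ℤ) by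
      push_cast; ring, zpow_natCast, pow_succ, pow_add, pow_mul, pow_mul]; ring
  have hb := hP.b_ne
  have hcs := hP.cs_ne
  rw [e]
  rw [gridPt] at h
  field_simp at h
  refine mul_left_cancel₀ hb ?_
  linear_combination P.bs * h + hP.bc_eq_bscs

lemma one_add_ne₄ (hP : P.Valid) {M : ℕ} (hM : M < P.n) :
    1 + P.q / (P.q ^ 2) ^ P.n * (P.cs / P.b) * P.gridPt M ≠ 0 := by
  intro h
  apply hP.ne₄ (P.n - M) (by omega) (by omega)
  have ht := pow_ne_zero M hP.t_ne
  have htn := pow_ne_zero P.n hP.t_ne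
  have hq := hP.q_ne
  have e : P.q ^ ((2 * (P.n - M : ℕ) : ℤ) - 1) = (P.q ^ 2) ^ P.n / ((P.q ^ 2) ^ M * P.q) := by
    rw [eq_div_iff (mul_ne_zero ht hq), ← pow_mul, ← pow_mul, ← pow_succ, ← zpow_natCast,
      ← zpow_natCast, ← zpow_add₀ hq]
    congr 1
    push_cast [Nat.cast_sub hM.le]; ring
  have hb := hP.b_ne
  rw [e]
  rw [gridPt] at h
  field_simp at h ⊢
  linear_combination P.r₀ * P.cd * h - P.cs * P.q * (P.q ^ 2) ^ M * hP.mul_bdcd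

end Params.Valid

/-! ### Ratios of consecutive weights k_M. -/

lemma qPoch_succ (a p : ℂ) (k : ℕ) : qPoch a p (k + 1) = qPoch a p k * (1 - a * p ^ k) :=
  prod_range_succ _ _

lemma ratio_step {n₁ n₂ n₃ n₄ d₁ d₂ d₃ d₄ f₁ f₂ f₃ f₄ g₁ g₂ g₃ g₄ s₀ s₁ a r ρ : ℂ}
    (hg : g₁ * g₂ * g₃ * g₄ ≠ 0) (hρ : ρ ≠ 0) :
    n₁ * f₁ * (n₂ * f₂) * (n₃ * f₃) * (n₄ * f₄) / (d₁ * g₁ * (d₂ * g₂) * (d₃ * g₃) * (d₄ * g₄))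
        * (s₁ / (r * ρ * a)) * (s₀ * (g₁ * g₂ * g₃ * g₄) * ρ)
      = n₁ * n₂ * n₃ * n₄ / (d₁ * d₂ * d₃ * d₄) * (s₀ / (r * a)) * (s₁ * (f₁ * f₂ * f₃ * f₄)) := by
  have e1 : n₁ * f₁ * (n₂ * f₂) * (n₃ * f₃) * (n₄ * f₄)
      / (d₁ * g₁ * (d₂ * g₂) * (d₃ * g₃) * (d₄ * g₄))
      = n₁ * n₂ * n₃ * n₄ / (d₁ * d₂ * d₃ * d₄) * (f₁ * f₂ * f₃ * f₄ / (g₁ * g₂ * g₃ * g₄)) := by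
    rw [div_mul_div_comm]; congr 1 <;> ring
  have e2 : s₁ / (r * ρ * a) = s₁ / (r * a) / ρ := by rw [div_div]; congr 1; ring
  rw [e1, e2]
  generalize g₁ * g₂ * g₃ * g₄ = g at *
  generalize n₁ * n₂ * n₃ * n₄ / (d₁ * d₂ * d₃ * d₄) = v
  generalize f₁ * f₂ * f₃ * f₄ = f
  have e3 : f / g * g = f := div_mul_cancel₀ _ hg
  have e4 : s₁ / (r * a) / ρ * ρ = s₁ / (r * a) := div_mul_cancel₀ _ hρ
  calc v * (f / g) * (s₁ / (r * a) / ρ) * (s₀ * g * ρ)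
      = v * (f / g * g) * (s₁ / (r * a) / ρ * ρ) * s₀ := by ring
    _ = v * (s₀ / (r * a)) * (s₁ * f) := by rw [e3, e4]; ring

namespace Params.Valid

variable {P : Params}

lemma kDiamond_zero (hk : P.bd / P.cd ≠ 1) : kDiamond P 0 ≠ 0 := by
  have : 1 - P.bd / P.cd ≠ 0 := sub_ne_zero.2 hk.symm
  simp [kDiamond, kCoeff, qPoch, this]

/-- The ratio k_{M+1}/k_M is cleared of denominators, and its q-shifted factors are rewritten
through grid points, so that it can be matched with the coefficients of `numInhom`. -/
lemma kDiamond_succ (hP : P.Valid)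
    (hk : P.bd / P.cd ≠ 1 ∧ P.bd / P.cd ≠ P.q ^ (-(4 * P.n : ℤ))) {M : ℕ} (hM : M < P.n) :
    kDiamond P (M + 1) * ((1 - P.gridPt M ^ 2) * ((1 - (P.q ^ 2) ^ (M + 1))
        * (1 + P.q / (P.q ^ 2) ^ P.n * (P.cs / P.b) * P.gridPt M)
        * (1 + P.q * (P.bs / P.b) * P.gridPt M)
        * (1 - P.gridPt P.n * P.gridPt (M + 1))) * (P.b / P.c))
      = kDiamond P M * ((1 - P.gridPt (M + 1) ^ 2) * ((1 + P.q * (P.b / P.bs) * P.gridPt M)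
        * (1 + P.q * (P.q ^ 2) ^ P.n * (P.b / P.cs) * P.gridPt M)
        * (1 - P.gridPt 0 * P.gridPt M) * (1 - P.gridPt M / P.gridPt P.n))) := by
  have hq := hP.q_ne
  have hb := hP.b_ne
  have hc := hP.c_ne
  have hbs := hP.bs_ne
  have hcs := hP.cs_ne
  have hbd := hP.bd_ne
  have hcd := hP.cd_ne
  have hr := hP.r₀_ne
  have htM := pow_ne_zero M hP.t_ne
  have htn := pow_ne_zero P.n hP.t_ne
  have a1 : P.bd / P.cd = (P.r₀ * P.bd) ^ 2 := by
    rw [div_eq_iff hP.cd_ne]; linear_combination -P.bd * hP.mul_bdcd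
  have e1 : P.q ^ (-(2 * P.n : ℤ)) = ((P.q ^ 2) ^ P.n)⁻¹ := by
    rw [zpow_neg, ← pow_mul]; norm_cast
  have e2 : P.q ^ (2 * P.n) = (P.q ^ 2) ^ P.n := pow_mul _ _ _
  have e3 : P.q ^ (1 - 2 * P.n : ℤ) = P.q / (P.q ^ 2) ^ P.n := by
    rw [sub_eq_add_neg, zpow_add₀ hq, e1, zpow_one]; rfl
  have e4 : ∀ m, P.q ^ (4 * m) = (P.q ^ 2) ^ m * (P.q ^ 2) ^ m := by
    intro m; rw [← pow_mul, ← pow_add]; congr 1; ring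
  have hcd' : P.cd = 1 / (P.r₀ ^ 2 * P.bd) := by
    rw [eq_div_iff (by positivity)]; linear_combination hP.mul_bdcd
  have f1 : 1 - -(P.bd * (P.cs * ((P.q ^ 2) ^ P.n)⁻¹) / P.c * P.r₀ * ((P.q ^ 2) ^ P.n * P.q))
      * (P.q ^ 2) ^ M = 1 + P.q * (P.b / P.bs) * P.gridPt M := by
    rw [hP.div_eq, gridPt]; field_simp; ring
  have f2 : 1 - -(P.b * (P.bs * (P.q ^ 2) ^ P.n) / P.cd * P.r₀ * P.q) * (P.q ^ 2) ^ M
      = 1 + P.q * (P.q ^ 2) ^ P.n * (P.b / P.cs) * P.gridPt M := by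
    have h : P.bs * P.r₀ / P.cd = P.r₀ * P.bd / P.cs := by
      rw [div_eq_div_iff hcd hcs]; refine mul_left_cancel₀ hr ?_
      linear_combination hP.mul_bscs - hP.mul_bdcd
    rw [gridPt]
    linear_combination P.q * P.b * (P.q ^ 2) ^ P.n * (P.q ^ 2) ^ M * h
  have f3 : 1 - P.bd / P.cd * (P.q ^ 2) ^ M = 1 - P.gridPt 0 * P.gridPt M := by
    rw [a1, gridPt, gridPt]; ring
  have f4 : 1 - ((P.q ^ 2) ^ P.n)⁻¹ * (P.q ^ 2) ^ M = 1 - P.gridPt M / P.gridPt P.n := by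
    rw [gridPt, gridPt]; field_simp
  have g1 : 1 - P.q ^ 2 * (P.q ^ 2) ^ M = 1 - (P.q ^ 2) ^ (M + 1) := by ring
  have g2 : 1 - -(P.bd * (P.cs * ((P.q ^ 2) ^ P.n)⁻¹) / P.b * P.r₀ * P.q) * (P.q ^ 2) ^ M
      = 1 + P.q / (P.q ^ 2) ^ P.n * (P.cs / P.b) * P.gridPt M := by
    rw [gridPt]; field_simp; ring
  have g3 : 1 - -(P.c * (P.bs * (P.q ^ 2) ^ P.n) / P.cd * P.r₀ * (P.q / (P.q ^ 2) ^ P.n))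
      * (P.q ^ 2) ^ M = 1 + P.q * (P.bs / P.b) * P.gridPt M := by
    have h : P.c * P.r₀ / P.cd = P.r₀ * P.bd / P.b := by
      rw [div_eq_div_iff hcd hb]; refine mul_left_cancel₀ hr ?_
      linear_combination hP.mul_bc - hP.mul_bdcd
    have h' : (P.q ^ 2) ^ P.n * (P.q / (P.q ^ 2) ^ P.n) = P.q := by field_simp
    rw [gridPt]
    linear_combination P.bs * P.q * (P.q ^ 2) ^ M * h
      + P.c * P.bs / P.cd * P.r₀ * (P.q ^ 2) ^ M * h'
  have g4 : 1 - P.bd / P.cd * ((P.q ^ 2) ^ P.n * P.q ^ 2) * (P.q ^ 2) ^ M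
      = 1 - P.gridPt P.n * P.gridPt (M + 1) := by
    rw [a1, gridPt, gridPt]; ring
  have s1 : ∀ m, 1 - P.bd / P.cd * ((P.q ^ 2) ^ m * (P.q ^ 2) ^ m) = 1 - P.gridPt m ^ 2 := by
    intro m; rw [a1, gridPt]; ring
  have hg1 : 1 - (P.q ^ 2) ^ (M + 1) ≠ 0 := sub_ne_zero.2 (hP.t_pow_ne_one M.succ_pos).symm
  have hg2 := hP.one_add_ne₄ hM
  have hg3 := hP.one_add_ne₂ hM
  have hg4 : 1 - P.gridPt P.n * P.gridPt (M + 1) ≠ 0 :=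
    sub_ne_zero.2 (hP.gridPt_mul_ne_one hk (by omega)).symm
  simp only [kDiamond, kCoeff, qPoch_succ, pow_succ _ (2 * P.n), pow_add _ (2 * P.n) 2, e1, e2, e3, e4]
  rw [f1, f2, f3, f4, g1, g2, g3, g4, s1, s1, pow_succ (P.b / P.c)]
  have hbc : P.b / P.c ≠ 0 := div_ne_zero hb hc
  exact ratio_step (mul_ne_zero (mul_ne_zero (mul_ne_zero hg1 hg2) hg3) hg4) hbc

end Params.Valid

/-! ### Askey-Wilson operators restricted to the grid. -/

namespace Params

/-- The value of a polynomial at the grid points. -/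
noncomputable def gridVal (P : Params) (p : ℂ[X]) (M : ℕ) : ℂ := p.eval (joukowski (P.gridPt M))

/-- The upward coefficient of an Askey-Wilson operator on the grid. -/
noncomputable def upCoeff (P : Params) (N : ℂ → ℂ) (M : ℕ) : ℂ := P.ratCoeff N (P.gridPt M)

/-- The downward coefficient of an Askey-Wilson operator on the grid. -/
noncomputable def downCoeff (P : Params) (N : ℂ → ℂ) (M : ℕ) : ℂ := P.ratCoeff N (P.gridPt M)⁻¹

end Params

namespace Params.Valid

variable {P : Params}

lemma gridPt_sq_ne_one (hP : P.Valid)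
    (hk : P.bd / P.cd ≠ 1 ∧ P.bd / P.cd ≠ P.q ^ (-(4 * P.n : ℤ))) {M : ℕ} (hM : M ≤ P.n) :
    P.gridPt M ^ 2 ≠ 1 := by
  rw [sq]; exact hP.gridPt_mul_ne_one hk (by omega)

lemma one_sub_up_ne (hP : P.Valid)
    (hk : P.bd / P.cd ≠ 1 ∧ P.bd / P.cd ≠ P.q ^ (-(4 * P.n : ℤ))) {M : ℕ} (hM : M < P.n) :
    1 - P.q ^ 2 * P.gridPt M ^ 2 ≠ 0 := by
  have h := hP.gridPt_mul_ne_one hk (by omega : M + (M + 1) ≤ 2 * P.n)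
  rw [gridPt_succ] at h
  intro h'
  exact h (by linear_combination -h')

lemma one_sub_down_ne (hP : P.Valid)
    (hk : P.bd / P.cd ≠ 1 ∧ P.bd / P.cd ≠ P.q ^ (-(4 * P.n : ℤ))) {M : ℕ} (hM : M < P.n) :
    1 - P.q ^ 2 * (P.gridPt (M + 1))⁻¹ ^ 2 ≠ 0 := by
  have h := hP.gridPt_mul_ne_one hk (by omega : M + (M + 1) ≤ 2 * P.n)
  have h1 := hP.gridPt_ne M
  have h2 := hP.q_ne
  rw [gridPt_succ] at h ⊢
  intro h'
  field_simp at h'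
  exact h (by linear_combination h')

lemma awNum_gridPt_n (hP : P.Valid) (c d : ℂ) :
    awNum (P.r₀ * P.bd) (P.gridPt P.n)⁻¹ c d (P.gridPt P.n) = 0 := by
  simp [awNum, inv_mul_cancel₀ (hP.gridPt_ne P.n)]

lemma awNum_gridPt_zero (hP : P.Valid) (c d : ℂ) :
    awNum (P.r₀ * P.bd) (P.gridPt P.n)⁻¹ c d (P.gridPt 0)⁻¹ = 0 := by
  have := hP.gridPt_ne 0
  rw [gridPt_zero] at *
  rw [awNum, mul_inv_cancel₀ this]; ring

/-- The operator does not leave the grid: the numerator vanishes at z_n, which kills the step up,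
and at z_0⁻¹, which kills the step down. Hence neither a possible zero of 1 - t z² at these ends nor
the truncated index `0 - 1` matters. -/
lemma awOp_gridPt (hP : P.Valid)
    (hk : P.bd / P.cd ≠ 1 ∧ P.bd / P.cd ≠ P.q ^ (-(4 * P.n : ℤ))) {M : ℕ} (hM : M ≤ P.n)
    {N : ℂ → ℂ} (hn : N (P.gridPt P.n) = 0) (h0 : N (P.gridPt 0)⁻¹ = 0) (p : ℂ[X]) :
    awOp (P.q ^ 2) N p (P.gridPt M)
      = gridOp (P.upCoeff N) (P.downCoeff N) (P.gridVal p) M := by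
  rw [awOp, gridOp, halfOp_eq_of_or hP.t_ne (hP.gridPt_ne M), halfOp_eq_of_or hP.t_ne
    (inv_ne_zero (hP.gridPt_ne M)), joukowski_inv, upCoeff, downCoeff, ratCoeff, ratCoeff,
    gridVal, gridVal, gridVal, gridPt_succ]
  · congr 1
    rcases M with _ | M
    · simp [h0]
    · rw [Nat.add_sub_cancel, ← joukowski_inv (P.gridPt M), gridPt_succ, mul_inv,
        mul_inv_cancel_left₀ hP.t_ne]
  · rcases M with _ | M
    · exact Or.inr h0
    · exact Or.inl (hP.one_sub_down_ne hk hM)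
  · rcases eq_or_lt_of_le hM with rfl | h
    · exact Or.inr hn
    · exact Or.inl (hP.one_sub_up_ne hk h)

lemma numHom_n (hP : P.Valid) : P.numHom (P.gridPt P.n) = 0 := hP.awNum_gridPt_n _ _
lemma numHom_zero (hP : P.Valid) : P.numHom (P.gridPt 0)⁻¹ = 0 := hP.awNum_gridPt_zero _ _
lemma numInhom_n (hP : P.Valid) : P.numInhom (P.gridPt P.n) = 0 := hP.awNum_gridPt_n _ _
lemma numInhom_zero (hP : P.Valid) : P.numInhom (P.gridPt 0)⁻¹ = 0 := hP.awNum_gridPt_zero _ _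

lemma numHom_prod (hP : P.Valid) :
    P.r₀ * P.bd * (P.gridPt P.n)⁻¹ * (-(P.q * (P.q ^ 2) ^ P.n * (P.b / P.cs)))
      * (-(P.q * (P.bs / P.b))) = P.bs / P.cs * P.q ^ 2 := by
  have h1 := hP.q_ne
  have h2 := hP.b_ne
  have h3 := hP.cs_ne
  have h4 := hP.r₀_ne
  have h5 := hP.bd_ne
  have h6 := pow_ne_zero P.n hP.t_ne
  rw [gridPt]
  field_simp

lemma numInhom_prod (hP : P.Valid) :
    P.r₀ * P.bd * (P.gridPt P.n)⁻¹ * (-(P.q * (P.q ^ 2) ^ P.n * (P.b / P.cs)))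
      * (-(P.q * (P.b / P.bs))) = P.b / P.c * P.q ^ 2 := by
  have h1 := hP.q_ne
  have h2 := hP.b_ne
  have h3 := hP.cs_ne
  have h4 := hP.r₀_ne
  have h5 := hP.bd_ne
  have h6 := pow_ne_zero P.n hP.t_ne
  rw [hP.div_eq, gridPt]
  field_simp

lemma exists_isAWImage_numHom (hP : P.Valid) (k : ℕ) (p : ℂ[X]) (hp : p.natDegree ≤ k) :
    ∃ r : ℂ[X], r.natDegree ≤ k ∧ r.coeff k = awEig (P.q ^ 2) (P.bs / P.cs) k * p.coeff k ∧
      IsAWImage (P.q ^ 2) P.numHom p r :=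
  exists_isAWImage hP.t_ne (mul_ne_zero hP.r₀_ne hP.bd_ne) hP.numHom_prod k p hp

lemma exists_isAWImage_numInhom (hP : P.Valid) (k : ℕ) (p : ℂ[X]) (hp : p.natDegree ≤ k) :
    ∃ r : ℂ[X], r.natDegree ≤ k ∧ r.coeff k = awEig (P.q ^ 2) (P.b / P.c) k * p.coeff k ∧
      IsAWImage (P.q ^ 2) P.numInhom p r :=
  exists_isAWImage hP.t_ne (mul_ne_zero hP.r₀_ne hP.bd_ne) hP.numInhom_prod k p hp

/-- Detailed balance for the weights `k_M`. -/
lemma kDiamond_balance (hP : P.Valid)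
    (hk : P.bd / P.cd ≠ 1 ∧ P.bd / P.cd ≠ P.q ^ (-(4 * P.n : ℤ))) {M : ℕ} (hM : M < P.n) :
    kDiamond P (M + 1) * P.downCoeff P.numInhom (M + 1)
      = kDiamond P M * P.upCoeff P.numInhom M := by
  have hs := hP.kDiamond_succ hk hM
  have hq := hP.q_ne
  have hb := hP.b_ne
  have hbs := hP.bs_ne
  have hcs := hP.cs_ne
  have htn := pow_ne_zero P.n hP.t_ne
  have hg1 : 1 - (P.q ^ 2) ^ (M + 1) ≠ 0 := sub_ne_zero.2 (hP.t_pow_ne_one M.succ_pos).symm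
  have hg2 := hP.one_add_ne₄ hM
  have hg3 := hP.one_add_ne₂ hM
  have hg4 : 1 - P.gridPt P.n * P.gridPt (M + 1) ≠ 0 :=
    sub_ne_zero.2 (hP.gridPt_mul_ne_one hk (by omega)).symm
  have hs0 : 1 - P.gridPt M ^ 2 ≠ 0 := sub_ne_zero.2 (hP.gridPt_sq_ne_one hk hM.le).symm
  have hs1 : 1 - P.gridPt (M + 1) ^ 2 ≠ 0 := sub_ne_zero.2 (hP.gridPt_sq_ne_one hk hM).symm
  have hd := hP.one_sub_up_ne hk hM
  have hz := hP.gridPt_ne M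
  have hz' := hP.gridPt_ne (M + 1)
  have hzn := hP.gridPt_ne P.n
  have hZ : P.r₀ * P.bd = P.gridPt 0 := (gridPt_zero P).symm
  have hZ0 := hP.gridPt_ne 0
  have hpow : (P.q ^ 2) ^ (M + 1) = P.gridPt (M + 1) / P.gridPt 0 := by
    rw [gridPt_zero, gridPt, mul_div_cancel_left₀]; rwa [← gridPt_zero]
  have hc' : P.b / P.c = P.b ^ 2 / (P.bs * P.cs) := by
    rw [← hP.bc_eq_bscs, sq, mul_div_mul_left _ _ hb]
  -- Because z_{M+1} = t z_M, the downward denominator at M + 1 and the upward one at M share the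
  -- factor 1 - t z_M².
  have e2 : (1 - (P.gridPt (M + 1))⁻¹ ^ 2) * (1 - P.q ^ 2 * (P.gridPt (M + 1))⁻¹ ^ 2)
      = (1 - P.gridPt (M + 1) ^ 2) * (1 - P.q ^ 2 * P.gridPt M ^ 2)
        * (P.q ^ 2 / P.gridPt (M + 1) ^ 4) := by
    rw [gridPt_succ]; field_simp; ring
  have e3 : P.numInhom (P.gridPt (M + 1))⁻¹ = (1 - (P.q ^ 2) ^ (M + 1))
        * (1 + P.q / (P.q ^ 2) ^ P.n * (P.cs / P.b) * P.gridPt M)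
        * (1 + P.q * (P.bs / P.b) * P.gridPt M)
        * (1 - P.gridPt P.n * P.gridPt (M + 1))
        * (P.b ^ 2 / (P.bs * P.cs) * (P.q ^ 2) / P.gridPt (M + 1) ^ 4) := by
    rw [numInhom, awNum, hpow, hZ]
    have : P.gridPt P.n = P.gridPt 0 * (P.q ^ 2) ^ P.n := by rw [gridPt_zero, gridPt]
    rw [this, gridPt_succ]
    field_simp
    ring
  have e4 : P.numInhom (P.gridPt M) = (1 + P.q * (P.b / P.bs) * P.gridPt M)
        * (1 + P.q * (P.q ^ 2) ^ P.n * (P.b / P.cs) * P.gridPt M)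
        * (1 - P.gridPt 0 * P.gridPt M) * (1 - P.gridPt M / P.gridPt P.n) := by
    rw [numInhom, awNum, hZ]
    ring
  rw [downCoeff, upCoeff, ratCoeff, ratCoeff, e2, e3, e4]
  rw [hc'] at hs
  generalize 1 + P.q / (P.q ^ 2) ^ P.n * (P.cs / P.b) * P.gridPt M = G2 at *
  generalize 1 + P.q * (P.bs / P.b) * P.gridPt M = G3 at *
  generalize 1 - P.gridPt P.n * P.gridPt (M + 1) = G4 at *
  generalize 1 - (P.q ^ 2) ^ (M + 1) = G1 at *
  generalize 1 - P.gridPt (M + 1) ^ 2 = S1 at *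
  generalize 1 - P.gridPt M ^ 2 = S0 at *
  generalize (1 + P.q * (P.b / P.bs) * P.gridPt M)
        * (1 + P.q * (P.q ^ 2) ^ P.n * (P.b / P.cs) * P.gridPt M)
        * (1 - P.gridPt 0 * P.gridPt M) * (1 - P.gridPt M / P.gridPt P.n) = F at *
  generalize 1 - P.q ^ 2 * P.gridPt M ^ 2 = R at *
  generalize P.b ^ 2 / (P.bs * P.cs) = ρ at *
  field_simp
  linear_combination hs

end Params.Valid

/-! ### Matching the homogeneous operator with the q-commutator. -/

namespace Params

/-- The difference between the diagonal parts of the homogeneous and of the inhomogeneous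
operators. -/
noncomputable def diagConst (P : Params) : ℂ :=
  P.bs + P.cs - P.cs / (P.q ^ 2 + 1)
    * (1 + P.q * (P.bs / P.b) * (P.r₀ * P.bd + (P.gridPt P.n)⁻¹
          - P.q * (P.q ^ 2) ^ P.n * (P.b / P.cs))
      - (P.r₀ * P.bd * (P.gridPt P.n)⁻¹
          - (P.r₀ * P.bd + (P.gridPt P.n)⁻¹) * (P.q * (P.q ^ 2) ^ P.n * (P.b / P.cs)))
      + P.q * (P.bs / P.b) * (P.r₀ * P.bd * (P.gridPt P.n)⁻¹
          * (P.q * (P.q ^ 2) ^ P.n * (P.b / P.cs))))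

/-- Half of the difference between the diagonal parts. -/
noncomputable def diagHalf (P : Params) (z : ℂ) : ℂ :=
  P.cs / (P.q ^ 2 + 1) * ((1 - P.r₀ * P.bd * z) * (1 - (P.gridPt P.n)⁻¹ * z)
    * (1 + P.q * (P.q ^ 2) ^ P.n * (P.b / P.cs) * z)
    * (1 - P.q * (P.bs / P.b) / z)) / (1 - z ^ 2)

end Params

namespace Params.Valid

variable {P : Params}

lemma c_eq (hP : P.Valid) : P.c = P.bs * P.cs / P.b := by
  rw [eq_div_iff hP.b_ne, ← hP.bc_eq_bscs]; ring

/-- The two numerators differ only in their last factor, and the relevant combination of these last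
factors is divisible by 1 - q² z². The exceptional alternative is harmless because 1 - r₀ b◇ z
divides every numerator involved. -/
lemma diagHalf_eq (hP : P.Valid) {z : ℂ} (hz : z ≠ 0)
    (h : 1 - P.q ^ 2 * z ^ 2 ≠ 0 ∨ 1 - P.r₀ * P.bd * z = 0) :
    P.cs * P.ratCoeff P.numHom z
      - P.c * P.q / (P.q ^ 2 + 1) * joukowski z * P.ratCoeff P.numInhom z = P.diagHalf z := by
  have hb := hP.b_ne
  have hbs := hP.bs_ne
  have hcs := hP.cs_ne
  have ht := hP.t_add_one_ne
  rw [ratCoeff, ratCoeff, numHom, numInhom, diagHalf, awNum, awNum]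
  rcases h with h | h
  · have e : P.cs * (1 + P.q * (P.bs / P.b) * z)
        - P.c * P.q / (P.q ^ 2 + 1) * (z + z⁻¹) * (1 + P.q * (P.b / P.bs) * z)
        = P.cs / (P.q ^ 2 + 1) * ((1 - P.q ^ 2 * z ^ 2) * (1 - P.q * (P.bs / P.b) / z)) := by
      rw [hP.c_eq]; field_simp; ring
    have e' : ∀ A D : ℂ, A * (1 + P.q * (P.bs / P.b) * z) / D * P.cs
        - P.c * P.q / (P.q ^ 2 + 1) * (z + z⁻¹) * (A * (1 + P.q * (P.b / P.bs) * z) / D)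
        = A / D * (P.cs / (P.q ^ 2 + 1)
          * ((1 - P.q ^ 2 * z ^ 2) * (1 - P.q * (P.bs / P.b) / z))) := by
      intro A D; rw [← e]; ring
    have e'' := e' ((1 - P.r₀ * P.bd * z) * (1 - (P.gridPt P.n)⁻¹ * z)
      * (1 + P.q * (P.q ^ 2) ^ P.n * (P.b / P.cs) * z)) ((1 - z ^ 2) * (1 - P.q ^ 2 * z ^ 2))
    have e4 : ∀ A E : ℂ, A / ((1 - z ^ 2) * (1 - P.q ^ 2 * z ^ 2)) * (P.cs / (P.q ^ 2 + 1)
          * ((1 - P.q ^ 2 * z ^ 2) * E)) = P.cs / (P.q ^ 2 + 1) * (A * E) / (1 - z ^ 2) := by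
      intro A E
      calc _ = A / ((1 - z ^ 2) * (1 - P.q ^ 2 * z ^ 2)) * (1 - P.q ^ 2 * z ^ 2)
            * (P.cs / (P.q ^ 2 + 1) * E) := by ring
        _ = A / (1 - z ^ 2) * (P.cs / (P.q ^ 2 + 1) * E) := by
            rw [← div_div, div_mul_cancel₀ _ h]
        _ = _ := by ring
    rw [e4] at e''
    rw [← e'', joukowski]
    ring
  · simp [h]

/-- Symmetrizing under z ↦ z⁻¹ also removes the denominator 1 - z². What remains is a symmetric
Laurent polynomial of degree one, hence affine in J(z); `diagConst` is defined so that its constant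
term fits. -/
lemma diagHalf_add_inv (hP : P.Valid) {z : ℂ} (hz : z ≠ 0) (h2 : z ^ 2 ≠ 1) :
    P.bs + P.cs - (P.diagHalf z + P.diagHalf z⁻¹)
      = P.q / (P.q ^ 2 + 1) * (P.b + P.c) * joukowski z + P.diagConst := by
  have hb := hP.b_ne
  have hcs := hP.cs_ne
  have ht := hP.t_add_one_ne
  have hzn := hP.gridPt_ne P.n
  have htn := pow_ne_zero P.n hP.t_ne
  have hr := hP.r₀_ne
  have hbd := hP.bd_ne
  have h3 : 1 - z ^ 2 ≠ 0 := sub_ne_zero.2 (Ne.symm h2)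
  have h4 : 1 - z⁻¹ ^ 2 = -(1 - z ^ 2) / z ^ 2 := by field_simp; ring
  rw [diagHalf, diagHalf, diagConst, joukowski, h4, hP.c_eq]
  have : P.gridPt P.n = P.r₀ * P.bd * (P.q ^ 2) ^ P.n := rfl
  rw [this]
  generalize (P.q ^ 2) ^ P.n = T at *
  field_simp
  ring

/-- The diagonal parts of the homogeneous and inhomogeneous operators on the grid agree. -/
lemma diag_eq (hP : P.Valid)
    (hk : P.bd / P.cd ≠ 1 ∧ P.bd / P.cd ≠ P.q ^ (-(4 * P.n : ℤ))) {M : ℕ} (hM : M < P.n) :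
    P.bs + P.cs - P.cs * (P.upCoeff P.numHom M + P.downCoeff P.numHom M)
      = P.q / (P.q ^ 2 + 1) * (P.b + P.c) * joukowski (P.gridPt M) + P.diagConst
        - P.c * P.q / (P.q ^ 2 + 1) * joukowski (P.gridPt M)
          * (P.upCoeff P.numInhom M + P.downCoeff P.numInhom M) := by
  have h1 := hP.diagHalf_eq (hP.gridPt_ne M) (Or.inl (hP.one_sub_up_ne hk hM))
  have h2 : 1 - P.q ^ 2 * (P.gridPt M)⁻¹ ^ 2 ≠ 0 ∨ 1 - P.r₀ * P.bd * (P.gridPt M)⁻¹ = 0 := by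
    rcases M with _ | M
    · right
      rw [← gridPt_zero, mul_inv_cancel₀ (hP.gridPt_ne 0), sub_self]
    · exact Or.inl (hP.one_sub_down_ne hk (by omega))
  have h3 := hP.diagHalf_eq (inv_ne_zero (hP.gridPt_ne M)) h2
  have h4 := hP.diagHalf_add_inv (hP.gridPt_ne M) (hP.gridPt_sq_ne_one hk hM.le)
  rw [joukowski_inv] at h3
  simp only [upCoeff, downCoeff]
  linear_combination h4 - h1 - h3

lemma hCoeff_succ (hP : P.Valid) {h₀ : ℂ} {M : ℕ} (hM : M < P.n) :
    hCoeff P h₀ (M + 1) * (1 + P.q * (P.bs / P.b) * P.gridPt M)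
      = hCoeff P h₀ M * (P.bs / P.b * P.q * P.gridPt M
        * (1 + P.q * (P.b / P.bs) * P.gridPt M)) := by
  have hg := hP.one_add_ne₂ hM
  have hq := hP.q_ne
  have hb := hP.b_ne
  have hbs := hP.bs_ne
  have hcd := hP.cd_ne
  have hr := hP.r₀_ne
  have hbd := hP.bd_ne
  have htM := pow_ne_zero M hP.t_ne
  have e1 : P.q ^ (-(2 * M : ℤ)) = ((P.q ^ 2) ^ M)⁻¹ := by
    rw [zpow_neg, ← pow_mul]; norm_cast
  have e2 : P.q ^ (4 * M) = (P.q ^ 2) ^ M * (P.q ^ 2) ^ M := by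
    rw [← pow_mul, ← pow_add]; congr 1; ring
  have hcs : P.cs = 1 / (P.r₀ ^ 2 * P.bs) := by
    rw [eq_div_iff (mul_ne_zero (pow_ne_zero 2 hr) hbs)]; linear_combination hP.mul_bscs
  have hcd' : P.cd = 1 / (P.r₀ ^ 2 * P.bd) := by
    rw [eq_div_iff (mul_ne_zero (pow_ne_zero 2 hr) hbd)]; linear_combination hP.mul_bdcd
  have hden : P.bd * P.q ^ (2 * M) + P.r₀ * P.q⁻¹ * P.cs * P.b
      = (1 + P.q * (P.bs / P.b) * P.gridPt M) * (P.b / (P.bs * P.r₀ * P.q)) := by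
    rw [gridPt, pow_mul, hcs]; field_simp; ring
  have hnum : P.cd * P.q ^ (-(2 * M : ℤ)) + P.r₀ * P.q * P.cs * P.b
      = (1 + P.q * (P.b / P.bs) * P.gridPt M) / (P.r₀ * P.gridPt M) := by
    rw [gridPt, e1, hcs, hcd']; field_simp
  rw [hCoeff, hCoeff, prod_range_succ, hden, hnum, e2, mul_assoc h₀, mul_assoc h₀, mul_assoc (∏ _ ∈ _, _)]
  congr 2
  have hz := hP.gridPt_ne M
  generalize 1 + P.q * (P.bs / P.b) * P.gridPt M = G at *
  generalize 1 + P.q * (P.b / P.bs) * P.gridPt M = F at *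
  rw [hcd', gridPt]
  field_simp

lemma hCoeff_ne_zero (hP : P.Valid) {h₀ : ℂ} (hh₀ : h₀ ≠ 0) {M : ℕ} (hM : M ≤ P.n) :
    hCoeff P h₀ M ≠ 0 := by
  induction M with
  | zero => simpa [hCoeff] using hh₀
  | succ M ih =>
    have h := hP.hCoeff_succ (h₀ := h₀) (M := M) hM
    intro h0
    rw [h0, zero_mul] at h
    exact mul_ne_zero (ih (by omega)) (mul_ne_zero (mul_ne_zero (mul_ne_zero
      (div_ne_zero hP.bs_ne hP.b_ne) hP.q_ne) (hP.gridPt_ne M)) (hP.one_add_ne₁ hM)) h.symm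

/-- Three of the four numerator factors are common to `numHom` and `numInhom`; the quotient of the
remaining ones is absorbed by h_{M+1}/h_M. So h_M is the diagonal conjugation between the two
tridiagonal operators. -/
lemma upCoeff_mul_hCoeff (hP : P.Valid) {h₀ : ℂ} {M : ℕ} (hM : M < P.n) :
    P.cs * P.upCoeff P.numHom M * hCoeff P h₀ (M + 1)
      = P.c * P.q * P.gridPt M * P.upCoeff P.numInhom M * hCoeff P h₀ M := by
  have h := hP.hCoeff_succ (h₀ := h₀) hM
  have hb := hP.b_ne
  rw [upCoeff, upCoeff, ratCoeff, ratCoeff, numHom, numInhom, awNum, awNum, hP.c_eq]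
  linear_combination P.cs * ((1 - P.r₀ * P.bd * P.gridPt M) *
    (1 - (P.gridPt P.n)⁻¹ * P.gridPt M)
    * (1 + P.q * (P.q ^ 2) ^ P.n * (P.b / P.cs) * P.gridPt M))
    / ((1 - P.gridPt M ^ 2) * (1 - P.q ^ 2 * P.gridPt M ^ 2)) * h

lemma downCoeff_mul_hCoeff (hP : P.Valid) {h₀ : ℂ} {M : ℕ} (hM : M < P.n) :
    P.cs * P.downCoeff P.numHom (M + 1) * hCoeff P h₀ M
      = P.c * P.q * (P.gridPt (M + 1))⁻¹ * P.downCoeff P.numInhom (M + 1)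
        * hCoeff P h₀ (M + 1) := by
  have h := hP.hCoeff_succ (h₀ := h₀) hM
  have hb := hP.b_ne
  have hbs := hP.bs_ne
  have hq := hP.q_ne
  have hz := hP.gridPt_ne M
  have key : P.cs * (1 + P.q * (P.bs / P.b) * (P.gridPt (M + 1))⁻¹) * hCoeff P h₀ M
      = P.c * P.q * (P.gridPt (M + 1))⁻¹ * (1 + P.q * (P.b / P.bs) * (P.gridPt (M + 1))⁻¹)
        * hCoeff P h₀ (M + 1) := by
    rw [gridPt_succ, hP.c_eq]
    have e : P.cs * (1 + P.q * (P.bs / P.b) * (P.q ^ 2 * P.gridPt M)⁻¹)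
        = P.cs * (P.bs / P.b) * (1 + P.q * (P.b / P.bs) * P.gridPt M) / (P.q * P.gridPt M) := by
      field_simp; ring
    have e' : P.bs * P.cs / P.b * P.q * (P.q ^ 2 * P.gridPt M)⁻¹
        * (1 + P.q * (P.b / P.bs) * (P.q ^ 2 * P.gridPt M)⁻¹)
        = P.cs * (1 + P.q * (P.bs / P.b) * P.gridPt M) / (P.q * P.gridPt M) ^ 2 := by
      field_simp; ring
    rw [e, e']
    generalize 1 + P.q * (P.bs / P.b) * P.gridPt M = G at *
    generalize 1 + P.q * (P.b / P.bs) * P.gridPt M = F at *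
    field_simp at h ⊢
    linear_combination -P.cs * h
  rw [downCoeff, downCoeff, ratCoeff, ratCoeff, numHom, numInhom, awNum, awNum]
  linear_combination ((1 - P.r₀ * P.bd * (P.gridPt (M + 1))⁻¹) *
    (1 - (P.gridPt P.n)⁻¹ * (P.gridPt (M + 1))⁻¹)
    * (1 + P.q * (P.q ^ 2) ^ P.n * (P.b / P.cs) * (P.gridPt (M + 1))⁻¹))
    / ((1 - (P.gridPt (M + 1))⁻¹ ^ 2) * (1 - P.q ^ 2 * (P.gridPt (M + 1))⁻¹ ^ 2)) * key

end Params.Valid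

/-! ### The q-commutator on the grid. -/

namespace Params

/-- The normalization of `A*` as a `q`-commutator of `A` and `A◇`. -/
noncomputable def commCoeff (P : Params) : ℂ := P.c * P.q / ((P.q ^ 2 + 1) * (P.q - P.q⁻¹))

/-- The coefficient of `X` in the `q`-commutator. -/
noncomputable def commShift (P : Params) : ℂ := (1 + P.b / P.c) * (P.q - P.q⁻¹)

end Params

namespace Params.Valid

variable {P : Params}

lemma commCoeff_ne_zero (hP : P.Valid) : P.commCoeff ≠ 0 :=
  div_ne_zero (mul_ne_zero hP.c_ne hP.q_ne) (mul_ne_zero hP.t_add_one_ne hP.q_sub_inv_ne)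

lemma commCoeff_mul (hP : P.Valid) :
    P.commCoeff * (P.q - P.q⁻¹) = P.c * P.q / (P.q ^ 2 + 1) := by
  have h1 := hP.q_sub_inv_ne
  have h2 := hP.t_add_one_ne
  rw [commCoeff]
  generalize P.q - P.q⁻¹ = s at *
  field_simp

lemma commCoeff_mul' (hP : P.Valid) : P.commCoeff * (P.q ^ 3 - P.q⁻¹) = P.c * P.q := by
  have h2 := hP.t_add_one_ne
  have h3 := hP.q_ne
  have : P.q ^ 3 - P.q⁻¹ = (P.q ^ 2 + 1) * (P.q - P.q⁻¹) := by field_simp; ring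
  rw [this, mul_comm (P.q ^ 2 + 1), ← mul_assoc, hP.commCoeff_mul, div_mul_cancel₀ _ h2]

lemma commCoeff_mul_commShift (hP : P.Valid) :
    P.commCoeff * P.commShift = P.q / (P.q ^ 2 + 1) * (P.b + P.c) := by
  have hc := hP.c_ne
  have h : P.commCoeff * P.commShift = P.commCoeff * (P.q - P.q⁻¹) * (1 + P.b / P.c) := by
    rw [commShift]; ring
  rw [h, hP.commCoeff_mul]
  field_simp
  ring

/-- The z⁻¹ terms cancel. This is why the q-commutator multiplies the upward coefficient by z_M and,
with z replaced by its inverse, the downward one by z_M⁻¹. -/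
lemma qComm_shift (hP : P.Valid) {z : ℂ} (hz : z ≠ 0) :
    P.q * joukowski (P.q ^ 2 * z) - P.q⁻¹ * joukowski z = (P.q ^ 3 - P.q⁻¹) * z := by
  have h3 := hP.q_ne
  rw [joukowski, joukowski]; field_simp; ring

/-- The `q`-commutator of the grid operator and the coordinate is tridiagonal. -/
lemma qComm_gridOp (hP : P.Valid) (f : ℕ → ℂ) (M : ℕ) :
    P.commCoeff * (P.q * gridOp (P.upCoeff P.numInhom) (P.downCoeff P.numInhom)
        (fun i => joukowski (P.gridPt i) * f i) M
      - P.q⁻¹ * (joukowski (P.gridPt M)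
        * gridOp (P.upCoeff P.numInhom) (P.downCoeff P.numInhom) f M)
      + P.commShift * joukowski (P.gridPt M) * f M)
    = P.c * P.q * P.gridPt M * P.upCoeff P.numInhom M * f (M + 1)
      + (P.q / (P.q ^ 2 + 1) * (P.b + P.c) * joukowski (P.gridPt M)
        - P.c * P.q / (P.q ^ 2 + 1) * joukowski (P.gridPt M)
          * (P.upCoeff P.numInhom M + P.downCoeff P.numInhom M)) * f M
      + P.c * P.q * (P.gridPt M)⁻¹ * P.downCoeff P.numInhom M * f (M - 1) := by
  have h1 := hP.commCoeff_mul
  have h2 := hP.commCoeff_mul'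
  have h3 := hP.commCoeff_mul_commShift
  have h4 : P.q * joukowski (P.gridPt (M + 1)) - P.q⁻¹ * joukowski (P.gridPt M)
      = (P.q ^ 3 - P.q⁻¹) * P.gridPt M := by
    rw [gridPt_succ]; exact hP.qComm_shift (hP.gridPt_ne M)
  have h5 : P.downCoeff P.numInhom M
      * (P.q * joukowski (P.gridPt (M - 1)) - P.q⁻¹ * joukowski (P.gridPt M))
      = P.downCoeff P.numInhom M * ((P.q ^ 3 - P.q⁻¹) * (P.gridPt M)⁻¹) := by
    rcases M with _ | M
    · rw [downCoeff, ratCoeff, hP.numInhom_zero]; ring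
    · have := hP.qComm_shift (inv_ne_zero (hP.gridPt_ne (M + 1)))
      rw [joukowski_inv, gridPt_succ, mul_inv, mul_inv_cancel_left₀ hP.t_ne, joukowski_inv] at this
      rw [Nat.add_sub_cancel, gridPt_succ, this, mul_inv]
  simp only [gridOp]
  linear_combination P.commCoeff * P.upCoeff P.numInhom M * f (M + 1) * h4
    + P.commCoeff * f (M - 1) * h5 + joukowski (P.gridPt M) * f M * h3
    - joukowski (P.gridPt M) * (P.upCoeff P.numInhom M + P.downCoeff P.numInhom M) * f M * h1
    + (P.upCoeff P.numInhom M * P.gridPt M * f (M + 1)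
      + P.downCoeff P.numInhom M * (P.gridPt M)⁻¹ * f (M - 1)) * h2

lemma upCoeff_numInhom_ne (hP : P.Valid)
    (hk : P.bd / P.cd ≠ 1 ∧ P.bd / P.cd ≠ P.q ^ (-(4 * P.n : ℤ))) {M : ℕ} (hM : M < P.n) :
    P.upCoeff P.numInhom M ≠ 0 := by
  refine div_ne_zero ?_ (mul_ne_zero (sub_ne_zero.2 (hP.gridPt_sq_ne_one hk hM.le).symm)
    (hP.one_sub_up_ne hk hM))
  rw [numInhom, awNum]
  refine mul_ne_zero (mul_ne_zero (mul_ne_zero ?_ ?_) ?_) ?_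
  · rw [← gridPt_zero]
    exact sub_ne_zero.2 (hP.gridPt_mul_ne_one hk (by omega)).symm
  · intro h
    obtain ⟨k, hk'⟩ := Nat.exists_eq_add_of_lt hM
    apply hP.t_pow_ne_one (Nat.succ_pos k)
    have h1 := hP.gridPt_ne P.n
    have h2 := hP.gridPt_ne M
    have h3 : P.gridPt P.n = P.gridPt M * (P.q ^ 2) ^ (k + 1) := by
      rw [hk', gridPt, gridPt, add_assoc, pow_add]; ring
    have h4 : P.gridPt P.n = P.gridPt M := by
      field_simp at h
      linear_combination h
    refine mul_left_cancel₀ h2 ?_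
    rw [Nat.succ_eq_add_one, ← h3, h4, mul_one]
  · convert hP.one_add_ne₃ hM using 1; ring
  · convert hP.one_add_ne₁ hM using 1; ring

lemma eigval_eq (hP : P.Valid) (N : ℕ) :
    P.cs * awEig (P.q ^ 2) (P.bs / P.cs) N + (P.bs + P.cs) = eigval P.q P.bs P.cs N := by
  have hcs := hP.cs_ne
  have e1 : P.q ^ (-(2 * N : ℤ)) = ((P.q ^ 2) ^ N)⁻¹ := by
    rw [zpow_neg, ← pow_mul]; norm_cast
  rw [awEig, eigval, e1, pow_mul]
  field_simp
  ring

/-- The grid values of the homogeneous and inhomogeneous eigenvectors are proportional. -/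
lemma grid_proportional (hP : P.Valid)
    (hk : P.bd / P.cd ≠ 1 ∧ P.bd / P.cd ≠ P.q ^ (-(4 * P.n : ℤ))) {h₀ : ℂ} (hh₀ : h₀ ≠ 0)
    {N : ℕ} {f v : ℕ → ℂ}
    (hf : ∀ M ≤ P.n, gridOp (P.upCoeff P.numHom) (P.downCoeff P.numHom) f M
      = awEig (P.q ^ 2) (P.bs / P.cs) N * f M)
    (hv : ∀ M ≤ P.n, P.commCoeff * (P.q * gridOp (P.upCoeff P.numInhom) (P.downCoeff P.numInhom)
        (fun i => joukowski (P.gridPt i) * v i) M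
      - P.q⁻¹ * (joukowski (P.gridPt M)
        * gridOp (P.upCoeff P.numInhom) (P.downCoeff P.numInhom) v M)
      + P.commShift * joukowski (P.gridPt M) * v M)
      = (eigval P.q P.bs P.cs N - P.diagConst) * v M) :
    ∀ M ≤ P.n, v 0 * (f M / hCoeff P h₀ M) = f 0 / hCoeff P h₀ 0 * v M := by
  refine three_term_proportional
    (α := fun M => P.c * P.q * P.gridPt M * P.upCoeff P.numInhom M)
    (β := fun M => P.q / (P.q ^ 2 + 1) * (P.b + P.c) * joukowski (P.gridPt M) + P.diagConst
        - P.c * P.q / (P.q ^ 2 + 1) * joukowski (P.gridPt M)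
          * (P.upCoeff P.numInhom M + P.downCoeff P.numInhom M))
    (γ := fun M => P.c * P.q * (P.gridPt M)⁻¹ * P.downCoeff P.numInhom M)
    (θ := eigval P.q P.bs P.cs N) (v := fun M => f M / hCoeff P h₀ M) (w := v) ?_ ?_ ?_ ?_
  · intro M hM
    exact mul_ne_zero (mul_ne_zero (mul_ne_zero hP.c_ne hP.q_ne) (hP.gridPt_ne M))
      (hP.upCoeff_numInhom_ne hk hM)
  · simp [downCoeff, ratCoeff, hP.numInhom_zero]
  -- Dividing by h_M turns the eigenvalue equation of f into the recurrence of the q-commutator.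
  -- Only M < n is needed, which avoids a possible zero of 1 - q² z_n².
  · intro M hM
    have h1 := hP.upCoeff_mul_hCoeff (h₀ := h₀) hM
    have h2 := hP.diag_eq hk hM
    have h3 := hf M hM.le
    have hM0 := hP.hCoeff_ne_zero hh₀ hM.le
    have hM1 := hP.hCoeff_ne_zero hh₀ (M := M + 1) hM
    have e1 : P.c * P.q * P.gridPt M * P.upCoeff P.numInhom M * (f (M + 1) / hCoeff P h₀ (M + 1))
        = P.cs * P.upCoeff P.numHom M * f (M + 1) / hCoeff P h₀ M := by
      rw [mul_div_assoc', div_eq_div_iff hM1 hM0]; linear_combination -f (M + 1) * h1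
    have e2 : P.c * P.q * (P.gridPt M)⁻¹ * P.downCoeff P.numInhom M
          * (f (M - 1) / hCoeff P h₀ (M - 1))
        = P.cs * P.downCoeff P.numHom M * f (M - 1) / hCoeff P h₀ M := by
      rcases M with _ | M
      · simp [downCoeff, ratCoeff, hP.numInhom_zero, hP.numHom_zero]
      · have h4 := hP.downCoeff_mul_hCoeff (h₀ := h₀) (M := M) (by omega)
        rw [Nat.add_sub_cancel, mul_div_assoc',
          div_eq_div_iff (hP.hCoeff_ne_zero hh₀ (by omega)) hM0]
        linear_combination -f M * h4
    rw [e1, e2, ← h2, ← hP.eigval_eq N]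
    rw [gridOp] at h3
    linear_combination P.cs / hCoeff P h₀ M * h3
  · intro M hM
    have h := hv M hM.le
    rw [hP.qComm_gridOp] at h
    linear_combination h

/-- The inhomogeneous eigenvectors are determined by their first entry. -/
lemma grid_eq_zero (hP : P.Valid)
    (hk : P.bd / P.cd ≠ 1 ∧ P.bd / P.cd ≠ P.q ^ (-(4 * P.n : ℤ))) {B : ℂ} {v : ℕ → ℂ}
    (hv : ∀ M ≤ P.n, P.commCoeff * (P.q * gridOp (P.upCoeff P.numInhom) (P.downCoeff P.numInhom)
        (fun i => joukowski (P.gridPt i) * v i) M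
      - P.q⁻¹ * (joukowski (P.gridPt M)
        * gridOp (P.upCoeff P.numInhom) (P.downCoeff P.numInhom) v M)
      + P.commShift * joukowski (P.gridPt M) * v M) = B * v M) (h0 : v 0 = 0) :
    ∀ M ≤ P.n, v M = 0 := by
  refine three_term_eq_zero
    (α := fun M => P.c * P.q * P.gridPt M * P.upCoeff P.numInhom M)
    (β := fun M => P.q / (P.q ^ 2 + 1) * (P.b + P.c) * joukowski (P.gridPt M)
        - P.c * P.q / (P.q ^ 2 + 1) * joukowski (P.gridPt M)
          * (P.upCoeff P.numInhom M + P.downCoeff P.numInhom M))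
    (γ := fun M => P.c * P.q * (P.gridPt M)⁻¹ * P.downCoeff P.numInhom M) (θ := B) ?_ ?_ ?_ h0
  · intro M hM
    exact mul_ne_zero (mul_ne_zero (mul_ne_zero hP.c_ne hP.q_ne) (hP.gridPt_ne M))
      (hP.upCoeff_numInhom_ne hk hM)
  · simp [downCoeff, ratCoeff, hP.numInhom_zero]
  · intro M hM
    rw [← hv M hM.le, hP.qComm_gridOp]

/-- The inhomogeneous eigenvectors do not pair to zero with the weights `k_M`. -/
lemma eq_zero_of_sum_kDiamond (hP : P.Valid)
    (hk : P.bd / P.cd ≠ 1 ∧ P.bd / P.cd ≠ P.q ^ (-(4 * P.n : ℤ))) {B : ℂ} {v : ℕ → ℂ}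
    (hv : ∀ M ≤ P.n, P.commCoeff * (P.q * gridOp (P.upCoeff P.numInhom) (P.downCoeff P.numInhom)
        (fun i => joukowski (P.gridPt i) * v i) M
      - P.q⁻¹ * (joukowski (P.gridPt M)
        * gridOp (P.upCoeff P.numInhom) (P.downCoeff P.numInhom) v M)
      + P.commShift * joukowski (P.gridPt M) * v M) = B * v M)
    (hsum : ∑ M ∈ range (P.n + 1), kDiamond P M * v M = 0) : v 0 = 0 := by
  refine eval_eq_zero_of_sum_eq_zero (x := fun i => joukowski (P.gridPt i))
    (lam := awEig (P.q ^ 2) (P.b / P.c)) ?_ ?_ ?_ (fun M hM => hP.kDiamond_balance hk hM)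
    (kDiamond_zero hk.1) hP.commCoeff_ne_zero ?_ ?_ hv hsum
  · intro M h0 hM
    exact (hP.joukowski_gridPt_injective hk hM h0).symm
  · simp [upCoeff, ratCoeff, hP.numInhom_n]
  · simp [downCoeff, ratCoeff, hP.numInhom_zero]
  · intro d p hp
    obtain ⟨r, h1, h2, h3⟩ := hP.exists_isAWImage_numInhom d p hp
    refine ⟨r, h1, h2, fun M hM => ?_⟩
    rw [← h3 _ (hP.gridPt_ne M) (hP.gridPt_sq_ne_one hk hM),
      hP.awOp_gridPt hk hM hP.numInhom_n hP.numInhom_zero]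
    rfl
  · intro d h
    have hq := hP.q_ne
    have hd := pow_ne_zero d hP.t_ne
    -- The growing powers of t cancel and `commShift` removes the constants, leaving a multiple of
    -- q⁴ - 1.
    have e : P.q * awEig (P.q ^ 2) (P.b / P.c) d - P.q⁻¹ * awEig (P.q ^ 2) (P.b / P.c) (d + 1)
        + P.commShift = ((P.q ^ 2) ^ d)⁻¹ * ((P.q ^ 2) ^ 2 - 1) / P.q ^ 3 := by
      rw [awEig, awEig, commShift, pow_succ]
      generalize P.b / P.c = ρ
      generalize (P.q ^ 2) ^ d = T at *
      field_simp
      ring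
    rw [e] at h
    exact div_ne_zero (mul_ne_zero (inv_ne_zero hd)
      (sub_ne_zero.2 (hP.t_pow_ne_one two_pos))) (pow_ne_zero 3 hq) h

end Params.Valid

/-! ### The inhomogeneous TQ polynomial. -/

namespace Params

/-- The value at `z` of the inhomogeneous `TQ` expression of a polynomial. -/
noncomputable def inhomTQ (P : Params) (Q : ℂ[X]) (z : ℂ) : ℂ :=
  P.commCoeff * (P.q * awOp (P.q ^ 2) P.numInhom (X * Q) z
      - P.q⁻¹ * (joukowski z * awOp (P.q ^ 2) P.numInhom Q z)
      + P.commShift * joukowski z * Q.eval (joukowski z))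
    + P.diagConst * Q.eval (joukowski z)
    - P.q * (P.q ^ 2) ^ P.n * P.b
      * (psi (P.q ^ 2) (P.r₀ * P.bd) (P.n + 1)).eval (joukowski z)

/-- The coefficient `μ_k` of the operator with numerator `numInhom`. -/
noncomputable def subInhom (P : Params) (k : ℕ) : ℂ :=
  awSub (P.q ^ 2) (P.r₀ * P.bd) (P.gridPt P.n)⁻¹ (-(P.q * (P.q ^ 2) ^ P.n * (P.b / P.cs)))
    (-(P.q * (P.b / P.bs))) k

/-- The leading coefficient of the inhomogeneous `TQ` polynomial, for `Q` with subleading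
coefficient exceeding that of `ψ_n` by `e`. -/
noncomputable def leadTQ (P : Params) (k : ℕ) (e : ℂ) : ℂ :=
  P.commCoeff * (P.q * awEig (P.q ^ 2) (P.b / P.c) (k + 1) * (joukowski (P.gridPt (k + 1)) + e)
      - P.q⁻¹ * (awEig (P.q ^ 2) (P.b / P.c) (k + 1) * joukowski (P.gridPt (k + 1))
        + P.subInhom k + awEig (P.q ^ 2) (P.b / P.c) k * e)
      + P.commShift * (joukowski (P.gridPt (k + 1)) + e)) + P.diagConst

end Params

namespace Params.Valid

variable {P : Params}

/-- The truncation condition: the parameters r₀ b◇ and z_n⁻¹ satisfy a b tⁿ = 1. Consequently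
ψ_{n+1} is an eigenvector of D. -/
lemma subInhom_n (hP : P.Valid) : P.subInhom P.n = 0 := by
  have h := hP.gridPt_ne P.n
  have h1 : P.r₀ * P.bd * (P.gridPt P.n)⁻¹ * (P.q ^ 2) ^ P.n = 1 := by
    rw [mul_right_comm]; exact mul_inv_cancel₀ h
  rw [subInhom, awSub, h1]; simp

lemma isAWImage_psi (hP : P.Valid) (k : ℕ) :
    IsAWImage (P.q ^ 2) P.numInhom (psi (P.q ^ 2) (P.r₀ * P.bd) (k + 1))
      (C (awEig (P.q ^ 2) (P.b / P.c) (k + 1)) * psi (P.q ^ 2) (P.r₀ * P.bd) (k + 1)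
        + C (P.subInhom k) * psi (P.q ^ 2) (P.r₀ * P.bd) k) :=
  isAWImage_psi_succ hP.t_ne (mul_ne_zero hP.r₀_ne hP.bd_ne) hP.numInhom_prod k

/-- This is the leading coefficient produced by the q-commutator in degree k. The negative powers of
t cancel, in contrast with the transposed operator, and for k = n the value is the coefficient of
ψ_{n+1} in `inhomTQ`. -/
lemma top_coeff_eq_zero (hP : P.Valid) (k : ℕ) :
    P.commCoeff * (P.q * awEig (P.q ^ 2) (P.b / P.c) (k + 1)
      - P.q⁻¹ * awEig (P.q ^ 2) (P.b / P.c) k + P.commShift) = P.q * (P.q ^ 2) ^ k * P.b := by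
  have hq := hP.q_ne
  have hc := hP.c_ne
  have hk := pow_ne_zero k hP.t_ne
  have e : P.q * awEig (P.q ^ 2) (P.b / P.c) (k + 1)
      - P.q⁻¹ * awEig (P.q ^ 2) (P.b / P.c) k + P.commShift
      = (P.q ^ 3 - P.q⁻¹) * (P.b / P.c * (P.q ^ 2) ^ k) := by
    rw [awEig, awEig, commShift, pow_succ]
    generalize P.b / P.c = ρ
    generalize (P.q ^ 2) ^ k = T at *
    field_simp
    ring
  rw [e, ← mul_assoc, hP.commCoeff_mul']
  field_simp

/-- The inhomogeneous `TQ` expression of a monic polynomial of degree `n` is a polynomial of degree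
at most `n`. -/
lemma exists_inhomTQ (hP : P.Valid) {k : ℕ} (hn : P.n = k + 1) {Q : ℂ[X]} (hQ : Q.Monic)
    (hd : Q.natDegree = k + 1) :
    ∃ T : ℂ[X], T.natDegree ≤ k + 1 ∧
      T.coeff (k + 1) = P.leadTQ k (Q.coeff k - (psi (P.q ^ 2) (P.r₀ * P.bd) (k + 1)).coeff k) ∧
      ∀ z, z ≠ 0 → z ^ 2 ≠ 1 → P.inhomTQ Q z = T.eval (joukowski z) := by
  set ψ := psi (P.q ^ 2) (P.r₀ * P.bd) with hψ
  set R : ℂ[X] := Q - ψ (k + 1) with hR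
  have hQ1 : Q.coeff (k + 1) = 1 := by rw [← hd]; exact hQ.coeff_natDegree
  have hRd : R.natDegree ≤ k := by
    have := natDegree_sub_C_mul_psi_le (P.q ^ 2) (P.r₀ * P.bd) hd.le
    rwa [hQ1, C.map_one, one_mul] at this
  have hXR : (X * R).natDegree ≤ k + 1 := by
    refine Polynomial.natDegree_mul_le.trans ?_
    rw [Polynomial.natDegree_X]; omega
  obtain ⟨r, hr1, hr2, hr3⟩ := hP.exists_isAWImage_numInhom k R hRd
  obtain ⟨s, hs1, hs2, hs3⟩ := hP.exists_isAWImage_numInhom (k + 1) (X * R) hXR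
  rw [Polynomial.coeff_X_mul] at hs2
  set x := joukowski (P.gridPt (k + 1)) with hx
  set l := awEig (P.q ^ 2) (P.b / P.c) with hl
  have hψ0 : (ψ k).natDegree ≤ k := (natDegree_psi _ _ _).le
  have hψ1 : (ψ (k + 1)).natDegree ≤ k + 1 := (natDegree_psi _ _ _).le
  have hX : ∀ p : ℂ[X], p.natDegree ≤ k → (X * p).natDegree ≤ k + 1 := by
    intro p hp
    refine Polynomial.natDegree_mul_le.trans ?_
    rw [Polynomial.natDegree_X]; omega
  have hC : ∀ (a : ℂ) (p : ℂ[X]), p.natDegree ≤ k + 1 → (C a * p).natDegree ≤ k + 1 :=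
    fun a p hp => (Polynomial.natDegree_C_mul_le _ _).trans hp
  have hadd : ∀ p p' : ℂ[X], p.natDegree ≤ k + 1 → p'.natDegree ≤ k + 1 →
      (p + p').natDegree ≤ k + 1 := fun p p' => Polynomial.natDegree_add_le_of_degree_le
  -- The witness comes from Q = ψ_n + R and X ψ_n = ψ_{n+1} + x ψ_n with x = J(z_n): all terms in
  -- ψ_{n+1} are dropped, as they cancel against the inhomogeneous term.
  refine ⟨C (P.commCoeff * ((P.q - P.q⁻¹) * l (k + 1) * x + P.commShift * x)) * ψ (k + 1)
    + C (P.commCoeff * P.q * x * P.subInhom k) * ψ k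
    + C (-P.commCoeff * P.q⁻¹ * P.subInhom k) * (X * ψ k)
    + C (P.commCoeff * P.q) * s + C (-P.commCoeff * P.q⁻¹) * (X * r)
    + C (P.commCoeff * P.commShift) * (X * R) + C P.diagConst * Q, ?_, ?_, ?_⟩
  · refine hadd _ _ (hadd _ _ (hadd _ _ (hadd _ _ (hadd _ _ (hadd _ _ ?_ ?_) ?_) ?_) ?_) ?_) ?_
    · exact hC _ _ hψ1
    · exact hC _ _ (hψ0.trans (Nat.le_succ k))
    · exact hC _ _ (hX _ hψ0)
    · exact hC _ _ hs1
    · exact hC _ _ (hX _ hr1)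
    · exact hC _ _ hXR
    · exact hC _ _ hd.le
  · have h1 : (ψ (k + 1)).coeff (k + 1) = 1 := coeff_psi _ _ _
    have h2 : (ψ k).coeff k = 1 := coeff_psi _ _ _
    have h3 : (ψ k).coeff (k + 1) = 0 :=
      Polynomial.coeff_eq_zero_of_natDegree_lt (Nat.lt_succ_of_le hψ0)
    have h4 : R.coeff k = Q.coeff k - (ψ (k + 1)).coeff k := Polynomial.coeff_sub _ _ _
    simp only [Polynomial.coeff_add, Polynomial.coeff_C_mul, Polynomial.coeff_X_mul, h1, h2, h3,
      hs2, hr2, hQ1, ← h4, leadTQ]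
    ring
  · intro z hz h2
    have e1 : X * Q = ψ (k + 1 + 1) + C x * ψ (k + 1) + X * R := by
      have : ψ (k + 1 + 1) = ψ (k + 1) * (X - C x) := psi_succ _ _ _
      rw [this, hR]; ring
    have e2 : Q = ψ (k + 1) + R := by rw [hR]; ring
    have i1 := hP.isAWImage_psi (k + 1)
    rw [← hn, hP.subInhom_n, hn] at i1
    have i2 := hP.isAWImage_psi k
    have i3 := ((i1.add (i2.C_mul x)).add hs3) z hz h2
    have i4 := (i2.add hr3) z hz h2
    rw [← hψ, ← e1] at i3
    rw [← hψ, ← e2] at i4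
    have htop := hP.top_coeff_eq_zero (k + 1)
    have e3 : (ψ (k + 1 + 1)).eval (joukowski z)
        = (ψ (k + 1)).eval (joukowski z) * (joukowski z - x) := by
      have : ψ (k + 1 + 1) = ψ (k + 1) * (X - C x) := psi_succ _ _ _
      rw [this]; simp
    have e4 : Q.eval (joukowski z) = (ψ (k + 1)).eval (joukowski z) + R.eval (joukowski z) := by
      rw [hR]; simp
    rw [inhomTQ, i3, i4, hn, ← hψ, ← htop]
    simp only [Polynomial.eval_add, Polynomial.eval_mul, Polynomial.eval_C, Polynomial.eval_X, e3,
      e4, ← hl]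
    ring

lemma sum_joukowski_gridPt (hP : P.Valid) (n : ℕ) :
    ∑ i ∈ range n, joukowski (P.gridPt i)
      = (P.r₀ * P.bd * ((P.q ^ 2) ^ n - 1) + (P.r₀ * P.bd)⁻¹ * (P.q ^ 2)
        * (1 - ((P.q ^ 2) ^ n)⁻¹)) / (P.q ^ 2 - 1) := by
  have hq := hP.q_ne
  have h1 : P.q ^ 2 - 1 ≠ 0 := sub_ne_zero.2 hP.t_ne_one
  have hZ := mul_ne_zero hP.r₀_ne hP.bd_ne
  induction n with
  | zero => simp
  | succ n ih =>
    have hn := pow_ne_zero n hP.t_ne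
    rw [sum_range_succ, ih, joukowski, gridPt, pow_succ]
    generalize (P.q ^ 2) ^ n = T at *
    generalize P.r₀ * P.bd = Z at *
    field_simp
    ring

/-- The last argument is the difference between the subleading coefficients of Q and ψ_n, each being
minus a sum of roots. The sum over the grid is geometric, and ζ² and ζ⁻² are monomials in r₀ b◇ and
qⁿ. -/
lemma leadTQ_eq (hP : P.Valid) {k : ℕ} (hn : P.n = k + 1) (u : Fin P.n → ℂ) :
    P.leadTQ k (∑ i ∈ range (k + 1), joukowski (P.gridPt i)
        - ∑ j, (P.q * u j ^ 2 + P.q⁻¹ * u j ^ (-2 : ℤ)))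
      = inhomEigenvalue P u := by
  have hq := hP.q_ne
  have hb := hP.b_ne
  have hbs := hP.bs_ne
  have hcs := hP.cs_ne
  have h1 : P.q ^ 2 - 1 ≠ 0 := sub_ne_zero.2 hP.t_ne_one
  have h2 := hP.t_add_one_ne
  have hZ := mul_ne_zero hP.r₀_ne hP.bd_ne
  have hW := pow_ne_zero P.n hq
  have e1 : P.ζ ^ (-2 : ℤ) = P.r₀ * P.bd * P.q ^ P.n := by rw [hP.ζ_eq]; ring
  have e2 : P.ζ ^ 2 = (P.r₀ * P.bd)⁻¹ * (P.q ^ P.n)⁻¹ := by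
    rw [hP.ζ_eq', hP.inv_gridPt_zero, zpow_neg, zpow_natCast]; ring
  have e3 : (P.q ^ 2) ^ P.n = P.q ^ P.n * P.q ^ P.n := by rw [← pow_mul, mul_comm, pow_mul, sq]
  have e4 : P.q ^ (2 * P.n) = P.q ^ P.n * P.q ^ P.n := by rw [pow_mul, e3]
  have e5 : P.q ^ (-(P.n : ℤ)) = (P.q ^ P.n)⁻¹ := by rw [zpow_neg, zpow_natCast]
  have e6 : (P.q ^ 2) ^ k = P.q ^ P.n * P.q ^ P.n / P.q ^ 2 := by
    rw [← e3, hn, pow_succ (P.q ^ 2), mul_div_cancel_right₀ _ hP.t_ne]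
  have e7 : P.q - P.q⁻¹ = (P.q ^ 2 - 1) / P.q := by field_simp
  have e8 : P.gridPt P.n = P.r₀ * P.bd * (P.q ^ P.n * P.q ^ P.n) := by rw [gridPt, e3]
  rw [inhomEigenvalue, leadTQ, hP.sum_joukowski_gridPt, subInhom, awSub, awEig, awEig, commShift,
    commCoeff, diagConst, qInt, hP.c_eq, ← hn, e1, e2, e6, e5, e4, e8, e3, e7, joukowski]
  generalize (∑ j, (P.q * u j ^ 2 + P.q⁻¹ * u j ^ (-2 : ℤ))) = S
  generalize P.q ^ P.n = W at *
  generalize P.r₀ * P.bd = Z at *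
  field_simp
  ring

end Params.Valid

/-! ### Bethe polynomials and exchange functions. -/

/-- The polynomial with roots `J(q u_j²)`. -/
noncomputable def bethePoly (q : ℂ) {N : ℕ} (u : Fin N → ℂ) : ℂ[X] :=
  ∏ j, (X - C (joukowski (q * u j ^ 2)))

/-- The polynomial with roots `J(q u_j²)`, `j ≠ i`. -/
noncomputable def betheCofactor (q : ℂ) {N : ℕ} (u : Fin N → ℂ) (i : Fin N) : ℂ[X] :=
  ∏ j ∈ univ.erase i, (X - C (joukowski (q * u j ^ 2)))

lemma monic_bethePoly (q : ℂ) {N : ℕ} (u : Fin N → ℂ) : (bethePoly q u).Monic :=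
  Polynomial.monic_prod_of_monic _ _ fun _ _ => Polynomial.monic_X_sub_C _

lemma natDegree_bethePoly (q : ℂ) {N : ℕ} (u : Fin N → ℂ) : (bethePoly q u).natDegree = N := by
  rw [bethePoly, Polynomial.natDegree_prod_of_monic _ _ fun _ _ => Polynomial.monic_X_sub_C _]
  simp

lemma bethePoly_eq (q : ℂ) {N : ℕ} (u : Fin N → ℂ) (i : Fin N) :
    bethePoly q u = (X - C (joukowski (q * u i ^ 2))) * betheCofactor q u i :=
  (mul_prod_erase univ _ (mem_univ i)).symm

lemma eval_bethePoly (q : ℂ) {N : ℕ} (u : Fin N → ℂ) (i : Fin N) :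
    (bethePoly q u).eval (joukowski (q * u i ^ 2)) = 0 := by
  rw [bethePoly_eq q u i]; simp

lemma bfun_mul_bfun {q u A B : ℂ} (hq : q ≠ 0) (hu : u ≠ 0) (hAB : A * B = q) :
    bfun (A * u) * bfun (B * u) = joukowski (q * u ^ 2) - joukowski (B ^ 2 / q) := by
  have hA : A ≠ 0 := left_ne_zero_of_mul (hAB ▸ hq)
  have hB : B ≠ 0 := right_ne_zero_of_mul (hAB ▸ hq)
  subst hAB
  simp only [bfun, joukowski]
  field_simp
  ring

lemma bfun_div_mul_bfun {q u v : ℂ} (hq : q ≠ 0) (hu : u ≠ 0) (hv : v ≠ 0) :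
    bfun (u * v⁻¹) * bfun (q * u * v) = joukowski (q * u ^ 2) - joukowski (q * v ^ 2) := by
  simp only [bfun, joukowski]
  field_simp
  ring

/-- With z = q u², the exchange functions f and h evaluate a linear factor of Q at the shifted
points t z⁻¹ and t z, which are the two shifts in `awOp`. -/
lemma fExch_eq {q u v : ℂ} (hq : q ≠ 0) (hu : u ≠ 0) (hv : v ≠ 0) :
    fExch q u v = (joukowski (q ^ 2 * (q * u ^ 2)⁻¹) - joukowski (q * v ^ 2))
      / (joukowski (q * u ^ 2) - joukowski (q * v ^ 2)) := by
  have h1 : bfun (q * v / u) * bfun (u * v)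
      = -(joukowski (q ^ 2 * (q * u ^ 2)⁻¹) - joukowski (q * v ^ 2)) := by
    simp only [bfun, joukowski]; field_simp; ring
  have h2 : bfun (v / u) * bfun (q * u * v)
      = -(joukowski (q * u ^ 2) - joukowski (q * v ^ 2)) := by
    simp only [bfun, joukowski]; field_simp; ring
  rw [fExch, h1, h2, neg_div_neg_eq]

lemma hExch_eq {q u v : ℂ} (hq : q ≠ 0) (hu : u ≠ 0) (hv : v ≠ 0) :
    hExch q u v = (joukowski (q ^ 2 * (q * u ^ 2)) - joukowski (q * v ^ 2))
      / (joukowski (q * u ^ 2) - joukowski (q * v ^ 2)) := by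
  have h1 : bfun (q ^ 2 * u * v) * bfun (q * u / v)
      = joukowski (q ^ 2 * (q * u ^ 2)) - joukowski (q * v ^ 2) := by
    simp only [bfun, joukowski]; field_simp; ring
  have h2 : bfun (q * u * v) * bfun (u / v)
      = joukowski (q * u ^ 2) - joukowski (q * v ^ 2) := by
    simp only [bfun, joukowski]; field_simp; ring
  rw [hExch, h1, h2]

lemma symVar_eq (q u : ℂ) : symVar q u = joukowski (q * u ^ 2) / (q + q⁻¹) := by
  rw [symVar, joukowski, mul_inv, zpow_neg]; rfl

lemma prod_fExch {q : ℂ} {N : ℕ} {u : Fin N → ℂ} (hq : q ≠ 0) (hu : ∀ i, u i ≠ 0) (i : Fin N) :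
    ∏ j ∈ univ.erase i, fExch q (u i) (u j)
      = (betheCofactor q u i).eval (joukowski (q ^ 2 * (q * u i ^ 2)⁻¹))
        / (betheCofactor q u i).eval (joukowski (q * u i ^ 2)) := by
  rw [betheCofactor, Polynomial.eval_prod, Polynomial.eval_prod, ← prod_div_distrib]
  refine prod_congr rfl fun j _ => ?_
  rw [fExch_eq hq (hu i) (hu j)]; simp

lemma prod_hExch {q : ℂ} {N : ℕ} {u : Fin N → ℂ} (hq : q ≠ 0) (hu : ∀ i, u i ≠ 0) (i : Fin N) :
    ∏ j ∈ univ.erase i, hExch q (u i) (u j)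
      = (betheCofactor q u i).eval (joukowski (q ^ 2 * (q * u i ^ 2)))
        / (betheCofactor q u i).eval (joukowski (q * u i ^ 2)) := by
  rw [betheCofactor, Polynomial.eval_prod, Polynomial.eval_prod, ← prod_div_distrib]
  refine prod_congr rfl fun j _ => ?_
  rw [hExch_eq hq (hu i) (hu j)]; simp

lemma prod_bfun {q : ℂ} {N : ℕ} {u : Fin N → ℂ} (hq : q ≠ 0) (hu : ∀ i, u i ≠ 0) (i : Fin N) :
    ∏ j ∈ univ.erase i, bfun (u i * (u j)⁻¹) * bfun (q * u i * u j)
      = (betheCofactor q u i).eval (joukowski (q * u i ^ 2)) := by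
  rw [betheCofactor, Polynomial.eval_prod]
  refine prod_congr rfl fun j _ => ?_
  rw [bfun_div_mul_bfun hq (hu i) (hu j)]; simp

lemma Admissible.joukowski_injective {q : ℂ} {N : ℕ} {u : Fin N → ℂ} (h : Admissible q u) :
    Function.Injective fun i => joukowski (q * u i ^ 2) := by
  intro i j hij
  by_contra hne
  apply h.2.2.2 i j hne
  rw [symVar_eq, symVar_eq]
  exact congrArg (· / (q + q⁻¹)) hij

lemma Admissible.cofactor_ne {q : ℂ} {N : ℕ} {u : Fin N → ℂ} (h : Admissible q u) (i : Fin N) :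
    (betheCofactor q u i).eval (joukowski (q * u i ^ 2)) ≠ 0 := by
  rw [betheCofactor, Polynomial.eval_prod, prod_ne_zero_iff]
  intro j hj
  simp only [Polynomial.eval_sub, Polynomial.eval_X, Polynomial.eval_C]
  exact sub_ne_zero.2 fun h' => (mem_erase.1 hj).1 (h.joukowski_injective h').symm

lemma Admissible.sq_ne_one {q : ℂ} {N : ℕ} {u : Fin N → ℂ} (h : Admissible q u)
    (i : Fin N) : (q * u i ^ 2) ^ 2 ≠ 1 := by
  intro h'
  apply h.2.2.1 i
  have hu := h.1 i
  rw [zpow_neg, show u i ^ (2 : ℤ) = u i ^ 2 by norm_cast, ← mul_inv]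
  apply eq_inv_of_mul_eq_one_left
  rw [← h']; ring

lemma Admissible.bfun_ne {q : ℂ} {N : ℕ} {u : Fin N → ℂ} (h : Admissible q u)
    (i : Fin N) : bfun (u i ^ 2) ≠ 0 := by
  intro h'
  apply h.2.1 i
  rw [zpow_neg, show u i ^ (2 : ℤ) = u i ^ 2 by norm_cast]
  exact sub_eq_zero.1 h'

lemma awOp_bethePoly (t : ℂ) (N' : ℂ → ℂ) (q : ℂ) {N : ℕ} (u : Fin N → ℂ) (i : Fin N) :
    awOp t N' (bethePoly q u) (q * u i ^ 2)
      = -(1 - t⁻¹) * (N' (q * u i ^ 2) / (q * u i ^ 2 * (1 - (q * u i ^ 2) ^ 2)))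
          * (betheCofactor q u i).eval (joukowski (t * (q * u i ^ 2)))
        + -(1 - t⁻¹) * (N' (q * u i ^ 2)⁻¹ / ((q * u i ^ 2)⁻¹ * (1 - (q * u i ^ 2)⁻¹ ^ 2)))
          * (betheCofactor q u i).eval (joukowski (t * (q * u i ^ 2)⁻¹)) := by
  rw [awOp, halfOp, halfOp, joukowski_inv, bethePoly_eq q u i, divDiff_X_sub_C_mul,
    divDiff_X_sub_C_mul]

lemma awOp_X_mul_bethePoly (t : ℂ) (N' : ℂ → ℂ) (q : ℂ) {N : ℕ} (u : Fin N → ℂ) (i : Fin N) :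
    awOp t N' (X * bethePoly q u) (q * u i ^ 2)
      = -(1 - t⁻¹) * (N' (q * u i ^ 2) / (q * u i ^ 2 * (1 - (q * u i ^ 2) ^ 2)))
          * (joukowski (t * (q * u i ^ 2))
            * (betheCofactor q u i).eval (joukowski (t * (q * u i ^ 2))))
        + -(1 - t⁻¹) * (N' (q * u i ^ 2)⁻¹ / ((q * u i ^ 2)⁻¹ * (1 - (q * u i ^ 2)⁻¹ ^ 2)))
          * (joukowski (t * (q * u i ^ 2)⁻¹)
            * (betheCofactor q u i).eval (joukowski (t * (q * u i ^ 2)⁻¹))) := by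
  have h : X * bethePoly q u = (X - C (joukowski (q * u i ^ 2))) * (X * betheCofactor q u i) := by
    rw [bethePoly_eq q u i]; ring
  rw [awOp, halfOp, halfOp, joukowski_inv, h, divDiff_X_sub_C_mul, divDiff_X_sub_C_mul]
  simp

lemma half_exp₁ : ((1 - 1) / 2 : ℤ) = 0 := by norm_num

lemma half_exp₂ : ((1 + 1) / 2 : ℤ) = 1 := by norm_num

lemma half_exp₃ : ((1 - -1) / 2 : ℤ) = 1 := by norm_num

lemma half_exp₄ : ((1 + -1) / 2 : ℤ) = 0 := by norm_num

/-! ### The functions Λ and the Bethe equations as conditions at the roots. -/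

namespace Params.Valid

variable {P : Params}

lemma ζ_zpow (hP : P.Valid) : P.ζ⁻¹ ^ 2 = P.r₀ * P.bd * P.q ^ P.n := by
  have h := hP.ζ_eq
  rw [zpow_neg, show P.ζ ^ (2 : ℤ) = P.ζ ^ 2 by norm_cast, ← inv_pow] at h
  rw [h]; ring

/-- Only ζ² and its inverse survive in the product. The two ζ-factors of Λ thereby become the
factors of the numerators with parameters r₀ b◇ and z_n⁻¹. -/
lemma ζ_factor_mul (hP : P.Valid) (A x y : ℂ) :
    (A * x * P.ζ⁻¹ - y * P.ζ) * (A * x * P.ζ - y * P.ζ⁻¹)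
      = A ^ 2 * x ^ 2 + y ^ 2
        - A * x * y * (P.r₀ * P.bd * P.q ^ P.n + (P.r₀ * P.bd * P.q ^ P.n)⁻¹) := by
  have hζ := hP.ζ_ne
  rw [← hP.ζ_zpow]
  field_simp
  ring

lemma q_pow_sq (P : Params) : (P.q ^ 2) ^ P.n = P.q ^ P.n * P.q ^ P.n := by
  rw [← pow_mul, mul_comm, pow_mul, sq]

lemma Lambda₁_one (hP : P.Valid) {u : ℂ} (hu : u ≠ 0) :
    Lambda₁ P 1 u = P.q * P.cs * u ^ 3 * P.numHom (P.q * u ^ 2)⁻¹ := by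
  have hq := hP.q_ne
  have hb := hP.b_ne
  have hcs := hP.cs_ne
  have hZ := mul_ne_zero hP.r₀_ne hP.bd_ne
  have hW := pow_ne_zero P.n hq
  have e1 : P.q ^ (-(P.n : ℤ) - 1) = (P.q ^ P.n * P.q)⁻¹ := by
    rw [show (-(P.n : ℤ) - 1) = -((P.n + 1 : ℕ) : ℤ) by push_cast; ring, zpow_neg, zpow_natCast,
      pow_succ]
  have e2 : P.q ^ (-(P.n : ℤ)) = (P.q ^ P.n)⁻¹ := by rw [zpow_neg, zpow_natCast]
  rw [Lambda₁, mul_assoc (_ / _), hP.ζ_factor_mul, e1, e2, numHom, awNum, gridPt, q_pow_sq, pow_succ P.q P.n]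
  simp only [half_exp₁, half_exp₂, zpow_zero, zpow_one]
  generalize P.q ^ P.n = W at *
  generalize P.r₀ * P.bd = Z at *
  field_simp
  ring

lemma Lambda₁_neg_one (hP : P.Valid) {u : ℂ} (hu : u ≠ 0) :
    Lambda₁ P (-1) u = P.q * P.c * u ^ 5 * P.numInhom (P.q * u ^ 2)⁻¹ := by
  have hq := hP.q_ne
  have hc := hP.c_ne
  have hcs := hP.cs_ne
  have hZ := mul_ne_zero hP.r₀_ne hP.bd_ne
  have hW := pow_ne_zero P.n hq
  have e1 : P.q ^ (-(P.n : ℤ) - 1) = (P.q ^ P.n * P.q)⁻¹ := by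
    rw [show (-(P.n : ℤ) - 1) = -((P.n + 1 : ℕ) : ℤ) by push_cast; ring, zpow_neg, zpow_natCast,
      pow_succ]
  have e2 : P.q ^ (-(P.n : ℤ)) = (P.q ^ P.n)⁻¹ := by rw [zpow_neg, zpow_natCast]
  rw [Lambda₁, mul_assoc (_ / _), hP.ζ_factor_mul, e1, e2, numInhom, awNum, gridPt, q_pow_sq,
    pow_succ P.q P.n, hP.div_eq]
  simp only [half_exp₃, half_exp₄, zpow_zero, zpow_one, zpow_neg_one]
  generalize P.q ^ P.n = W at *
  generalize P.r₀ * P.bd = Z at *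
  field_simp
  ring

lemma bfun_q_mul (q u : ℂ) : q * u ^ 2 - q⁻¹ * u ^ (-2 : ℤ) = bfun (q * u ^ 2) := by
  rw [bfun, mul_inv, zpow_neg]; rfl

lemma bfun_sq (u : ℂ) : u ^ 2 - u ^ (-2 : ℤ) = bfun (u ^ 2) := by
  rw [bfun, zpow_neg]; rfl

lemma Lambda₂_one (hP : P.Valid) {u : ℂ} (hu : u ≠ 0) :
    Lambda₂ P 1 u = bfun (u ^ 2) / bfun (P.q * u ^ 2)
      * (P.cs * (P.q ^ 3)⁻¹ * (u ^ 5)⁻¹ * P.numHom (P.q * u ^ 2)) := by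
  have hq := hP.q_ne
  have hb := hP.b_ne
  have hcs := hP.cs_ne
  have hZ := mul_ne_zero hP.r₀_ne hP.bd_ne
  have hW := pow_ne_zero P.n hq
  have e1 : P.q ^ (-(P.n : ℤ) - 1) = (P.q ^ P.n * P.q)⁻¹ := by
    rw [show (-(P.n : ℤ) - 1) = -((P.n + 1 : ℕ) : ℤ) by push_cast; ring, zpow_neg, zpow_natCast,
      pow_succ]
  have e2 : P.q ^ (-(P.n : ℤ)) = (P.q ^ P.n)⁻¹ := by rw [zpow_neg, zpow_natCast]
  have e3 : P.q ^ ((P.n : ℤ) - 1) = P.q ^ P.n / P.q := by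
    rw [zpow_sub₀ hq, zpow_natCast, zpow_one]
  have e4 := hP.ζ_factor_mul (P.q ^ P.n / P.q) u⁻¹ u
  rw [mul_comm] at e4
  rw [Lambda₂, bfun_q_mul, bfun_sq, mul_assoc (_ / _), e1, e2, e3, e4, numHom, awNum, gridPt, q_pow_sq]
  generalize bfun (P.q * u ^ 2) = B
  generalize bfun (u ^ 2) = A
  simp only [half_exp₁, half_exp₂, zpow_zero, zpow_one]
  generalize P.q ^ P.n = W at *
  generalize P.r₀ * P.bd = Z at *
  rw [div_eq_mul_inv, div_eq_mul_inv A B, mul_inv u B]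
  generalize B⁻¹ = B'
  field_simp
  ring

lemma Lambda₂_neg_one (hP : P.Valid) {u : ℂ} (hu : u ≠ 0) :
    Lambda₂ P (-1) u = bfun (u ^ 2) / bfun (P.q * u ^ 2)
      * (P.c * (P.q ^ 3)⁻¹ * (u ^ 3)⁻¹ * P.numInhom (P.q * u ^ 2)) := by
  have hq := hP.q_ne
  have hc := hP.c_ne
  have hcs := hP.cs_ne
  have hZ := mul_ne_zero hP.r₀_ne hP.bd_ne
  have hW := pow_ne_zero P.n hq
  have e1 : P.q ^ (-(P.n : ℤ) - 1) = (P.q ^ P.n * P.q)⁻¹ := by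
    rw [show (-(P.n : ℤ) - 1) = -((P.n + 1 : ℕ) : ℤ) by push_cast; ring, zpow_neg, zpow_natCast,
      pow_succ]
  have e2 : P.q ^ (-(P.n : ℤ)) = (P.q ^ P.n)⁻¹ := by rw [zpow_neg, zpow_natCast]
  have e3 : P.q ^ ((P.n : ℤ) - 1) = P.q ^ P.n / P.q := by
    rw [zpow_sub₀ hq, zpow_natCast, zpow_one]
  have e4 := hP.ζ_factor_mul (P.q ^ P.n / P.q) u⁻¹ u
  rw [mul_comm] at e4
  rw [Lambda₂, bfun_q_mul, bfun_sq, mul_assoc (_ / _), e1, e2, e3, e4, numInhom, awNum, gridPt,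
    q_pow_sq, hP.div_eq]
  generalize bfun (P.q * u ^ 2) = B
  generalize bfun (u ^ 2) = A
  simp only [half_exp₃, half_exp₄, zpow_zero, zpow_one, zpow_neg_one]
  generalize P.q ^ P.n = W at *
  generalize P.r₀ * P.bd = Z at *
  rw [div_eq_mul_inv, div_eq_mul_inv A B, mul_inv _ B]
  generalize B⁻¹ = B'
  field_simp
  ring

end Params.Valid

lemma bfun_eq_neg_div {z : ℂ} (hz : z ≠ 0) : bfun z = -(1 - z ^ 2) / z := by
  rw [bfun]; field_simp; ring

namespace Params.Valid

variable {P : Params}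

/-- At z = q u_i² the term in Q(J(z)) drops out, and the operator equals the Bethe function up to
factors that admissibility makes nonzero, among them b(u_i²). -/
lemma awOp_eq_zero_of_homBethe (hP : P.Valid) {N : ℕ} {w : Fin N → ℂ} (hw : Admissible P.q w)
    (i : Fin N) (h : homBethe P w i = 0) :
    awOp (P.q ^ 2) P.numHom (bethePoly P.q w) (P.q * w i ^ 2) = 0 := by
  have hq := hP.q_ne
  have hcs := hP.cs_ne
  have hu := hw.1 i
  have hA := hw.bfun_ne i
  have hF := hw.cofactor_ne i
  have hz : P.q * w i ^ 2 ≠ 0 := mul_ne_zero hq (pow_ne_zero 2 hu)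
  have hD : 1 - (P.q * w i ^ 2) ^ 2 ≠ 0 := sub_ne_zero.2 (hw.sq_ne_one i).symm
  have hD' : 1 - (P.q * w i ^ 2)⁻¹ ^ 2 = -(1 - (P.q * w i ^ 2) ^ 2) / (P.q * w i ^ 2) ^ 2 := by
    field_simp; ring
  rw [homBethe, prod_fExch hq hw.1, prod_hExch hq hw.1, hP.Lambda₁_one hu, hP.Lambda₂_one hu,
    bfun_eq_neg_div hz] at h
  rw [awOp_bethePoly, hD']
  generalize P.numHom (P.q * w i ^ 2)⁻¹ = Nm at *
  generalize P.numHom (P.q * w i ^ 2) = Np at *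
  generalize (betheCofactor P.q w i).eval (joukowski (P.q * w i ^ 2)) = F at *
  generalize (betheCofactor P.q w i).eval (joukowski (P.q ^ 2 * (P.q * w i ^ 2)⁻¹)) = Fm at *
  generalize (betheCofactor P.q w i).eval (joukowski (P.q ^ 2 * (P.q * w i ^ 2))) = Fp at *
  generalize bfun (w i ^ 2) = A at *
  generalize 1 - (P.q * w i ^ 2) ^ 2 = D at *
  have key : Fp * Np - P.q ^ 4 * w i ^ 8 * (Fm * Nm) = 0 := by
    have : A * P.cs * (Fp * Np - P.q ^ 4 * w i ^ 8 * (Fm * Nm)) = 0 := by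
      field_simp at h
      linear_combination -h
    exact (mul_eq_zero.1 this).resolve_left (mul_ne_zero hA hcs)
  field_simp
  linear_combination -(P.q ^ 2 - 1) * key

lemma awOp_qComm_bethePoly (hP : P.Valid) (u : Fin P.n → ℂ) (i : Fin P.n) (hu : u i ≠ 0) :
    P.commCoeff * (P.q * awOp (P.q ^ 2) P.numInhom (X * bethePoly P.q u) (P.q * u i ^ 2)
        - P.q⁻¹ * (joukowski (P.q * u i ^ 2)
          * awOp (P.q ^ 2) P.numInhom (bethePoly P.q u) (P.q * u i ^ 2)))
      = P.c * P.q * (-(1 - (P.q ^ 2)⁻¹)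
          * (P.numInhom (P.q * u i ^ 2) / (P.q * u i ^ 2 * (1 - (P.q * u i ^ 2) ^ 2)))
          * (P.q * u i ^ 2)
          * (betheCofactor P.q u i).eval (joukowski (P.q ^ 2 * (P.q * u i ^ 2)))
        + -(1 - (P.q ^ 2)⁻¹)
          * (P.numInhom (P.q * u i ^ 2)⁻¹ / ((P.q * u i ^ 2)⁻¹ * (1 - (P.q * u i ^ 2)⁻¹ ^ 2)))
          * (P.q * u i ^ 2)⁻¹
          * (betheCofactor P.q u i).eval (joukowski (P.q ^ 2 * (P.q * u i ^ 2)⁻¹))) := by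
  have hz : P.q * u i ^ 2 ≠ 0 := mul_ne_zero hP.q_ne (pow_ne_zero 2 hu)
  have h1 := hP.qComm_shift hz
  have h2 := hP.qComm_shift (inv_ne_zero hz)
  rw [joukowski_inv] at h2
  rw [awOp_X_mul_bethePoly, awOp_bethePoly, ← hP.commCoeff_mul']
  generalize -(1 - (P.q ^ 2)⁻¹)
    * (P.numInhom (P.q * u i ^ 2) / (P.q * u i ^ 2 * (1 - (P.q * u i ^ 2) ^ 2))) = hp at *
  generalize -(1 - (P.q ^ 2)⁻¹)
    * (P.numInhom (P.q * u i ^ 2)⁻¹ / ((P.q * u i ^ 2)⁻¹ * (1 - (P.q * u i ^ 2)⁻¹ ^ 2))) = hm at *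
  linear_combination P.commCoeff
    * (hp * (betheCofactor P.q u i).eval (joukowski (P.q ^ 2 * (P.q * u i ^ 2))) * h1
      + hm * (betheCofactor P.q u i).eval (joukowski (P.q ^ 2 * (P.q * u i ^ 2)⁻¹)) * h2)

lemma prod_bfun_eq_psi (hP : P.Valid) {u : ℂ} (hu : u ≠ 0) :
    ∏ k ∈ range (P.n + 1),
        bfun (P.q ^ ((1 / 2 : ℂ) + k - P.n / 2) * P.ζ * u)
          * bfun (P.q ^ ((1 / 2 : ℂ) + k - P.n / 2) * P.ζ⁻¹ * u)
      = (psi (P.q ^ 2) (P.r₀ * P.bd) (P.n + 1)).eval (joukowski (P.q * u ^ 2)) := by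
  have hq := hP.q_ne
  have hζ := hP.ζ_ne
  -- Reversing the ζ-factors pairs the exponents 1/2 + (n - k) - n/2 and 1/2 + k - n/2, whose sum is
  -- 1, as `bfun_mul_bfun` requires.
  rw [prod_mul_distrib, ← prod_range_reflect, ← prod_mul_distrib, psi, Polynomial.eval_prod]
  refine prod_congr rfl fun k hk => ?_
  have hk' : k ≤ P.n := Nat.lt_succ_iff.1 (mem_range.1 hk)
  have h1 : P.q ^ ((1 / 2 : ℂ) + (P.n + 1 - 1 - k : ℕ) - P.n / 2)
      * P.q ^ ((1 / 2 : ℂ) + k - P.n / 2) = P.q := by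
    rw [← Complex.cpow_add _ _ hq]
    have : (1 / 2 : ℂ) + (P.n + 1 - 1 - k : ℕ) - P.n / 2 + (1 / 2 + k - P.n / 2) = 1 := by
      rw [Nat.add_sub_cancel, Nat.cast_sub hk']; ring
    rw [this, Complex.cpow_one]
  have h2 : (P.q ^ ((1 / 2 : ℂ) + k - P.n / 2)) ^ 2 * P.q ^ P.n = P.q * (P.q ^ 2) ^ k := by
    rw [sq, ← Complex.cpow_add _ _ hq, ← Complex.cpow_natCast P.q P.n, ← Complex.cpow_add _ _ hq]
    have : (1 / 2 : ℂ) + k - P.n / 2 + (1 / 2 + k - P.n / 2) + P.n = ((2 * k + 1 : ℕ) : ℂ) := by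
      push_cast; ring
    rw [this, Complex.cpow_natCast, pow_succ, pow_mul, mul_comm]
  generalize P.q ^ ((1 / 2 : ℂ) + (P.n + 1 - 1 - k : ℕ) - P.n / 2) = A at *
  generalize P.q ^ ((1 / 2 : ℂ) + k - P.n / 2) = B at *
  rw [bfun_mul_bfun hq hu (A := A * P.ζ) (B := B * P.ζ⁻¹)]
  · simp only [Polynomial.eval_sub, Polynomial.eval_X, Polynomial.eval_C]
    congr 2
    rw [mul_pow, hP.ζ_zpow, div_eq_iff hq]
    linear_combination P.r₀ * P.bd * h2
  · rw [← h1]; field_simp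

lemma inhomTQ_eq_zero_of_inhomBethe (hP : P.Valid) {u : Fin P.n → ℂ} (hu : Admissible P.q u)
    (i : Fin P.n) (h : inhomBethe P u i = 0) :
    P.inhomTQ (bethePoly P.q u) (P.q * u i ^ 2) = 0 := by
  have hq := hP.q_ne
  have hc := hP.c_ne
  have hui := hu.1 i
  have hA := hu.bfun_ne i
  have hF := hu.cofactor_ne i
  have hz : P.q * u i ^ 2 ≠ 0 := mul_ne_zero hq (pow_ne_zero 2 hui)
  have hD : 1 - (P.q * u i ^ 2) ^ 2 ≠ 0 := sub_ne_zero.2 (hu.sq_ne_one i).symm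
  have hD' : 1 - (P.q * u i ^ 2)⁻¹ ^ 2 = -(1 - (P.q * u i ^ 2) ^ 2) / (P.q * u i ^ 2) ^ 2 := by
    field_simp; ring
  have ht : P.q ^ 2 - 1 ≠ 0 := sub_ne_zero.2 hP.t_ne_one
  have hbq : bfun P.q = (P.q ^ 2 - 1) / P.q := by rw [bfun]; field_simp
  have hpow : P.q ^ (1 + 2 * P.n) = P.q * (P.q ^ 2) ^ P.n := by rw [pow_add, pow_mul, pow_one]
  rw [inhomBethe, prod_fExch hq hu.1, prod_hExch hq hu.1, hP.Lambda₁_neg_one hui,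
    hP.Lambda₂_neg_one hui, prod_bfun hq hu.1, hP.prod_bfun_eq_psi hui, bfun_eq_neg_div hz, hbq,
    hpow] at h
  rw [inhomTQ, eval_bethePoly, mul_zero, mul_zero, add_zero, add_zero,
    hP.awOp_qComm_bethePoly u i hui, hD']
  generalize P.numInhom (P.q * u i ^ 2)⁻¹ = Nm at *
  generalize P.numInhom (P.q * u i ^ 2) = Np at *
  generalize (psi (P.q ^ 2) (P.r₀ * P.bd) (P.n + 1)).eval (joukowski (P.q * u i ^ 2)) = Ψ at *
  generalize (betheCofactor P.q u i).eval (joukowski (P.q * u i ^ 2)) = F at *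
  generalize (betheCofactor P.q u i).eval (joukowski (P.q ^ 2 * (P.q * u i ^ 2)⁻¹)) = Fm at *
  generalize (betheCofactor P.q u i).eval (joukowski (P.q ^ 2 * (P.q * u i ^ 2))) = Fp at *
  generalize bfun (u i ^ 2) = A at *
  generalize 1 - (P.q * u i ^ 2) ^ 2 = D at *
  generalize (P.q ^ 2) ^ P.n = T at *
  have key : P.c * (Fp * Np - P.q ^ 2 * u i ^ 4 * (Fm * Nm)) * (P.q ^ 2 - 1)
      + D * P.q ^ 2 * T * P.b * Ψ = 0 := by
    have : A * u i ^ 2 * (P.c * (Fp * Np - P.q ^ 2 * u i ^ 4 * (Fm * Nm)) * (P.q ^ 2 - 1)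
      + D * P.q ^ 2 * T * P.b * Ψ) = 0 := by
      generalize P.q ^ 2 - 1 = τ at *
      field_simp at h
      linear_combination h
    exact (mul_eq_zero.1 this).resolve_left (mul_ne_zero hA (pow_ne_zero 2 hui))
  field_simp
  linear_combination -key

end Params.Valid

/-! ### From Bethe roots to eigenvectors. -/

lemma eq_zero_of_coeff_eq_zero {N : ℕ} {r : ℂ[X]} (hr : r.natDegree ≤ N) (h0 : r.coeff N = 0)
    {x : Fin N → ℂ} (hx : Function.Injective x) (hroot : ∀ i, r.eval (x i) = 0) : r = 0 := by
  refine Polynomial.eq_zero_of_degree_lt_of_eval_index_eq_zero (s := univ) (v := x) hx.injOn ?_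
    fun i _ => hroot i
  rw [card_univ, Fintype.card_fin, Polynomial.degree_lt_iff_coeff_zero]
  intro m hm
  rcases eq_or_lt_of_le hm with h | h
  · rw [← h, h0]
  · exact Polynomial.coeff_eq_zero_of_natDegree_lt (lt_of_le_of_lt hr h)

lemma eq_C_mul_bethePoly {q : ℂ} {N : ℕ} {u : Fin N → ℂ} (hu : Admissible q u) {r : ℂ[X]}
    (hr : r.natDegree ≤ N) (hroot : ∀ i, r.eval (joukowski (q * u i ^ 2)) = 0) :
    r = C (r.coeff N) * bethePoly q u := by
  have h1 : (bethePoly q u).coeff N = 1 := by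
    have := (monic_bethePoly q u).coeff_natDegree
    rwa [natDegree_bethePoly] at this
  refine sub_eq_zero.1 (eq_zero_of_coeff_eq_zero (N := N) ?_ ?_ hu.joukowski_injective ?_)
  · refine (Polynomial.natDegree_sub_le_of_le hr ((Polynomial.natDegree_C_mul_le _ _).trans
      (natDegree_bethePoly q u).le)).trans (max_self _).le
  · rw [Polynomial.coeff_sub, Polynomial.coeff_C_mul, h1, mul_one, sub_self]
  · intro i
    rw [Polynomial.eval_sub, hroot, Polynomial.eval_mul, eval_bethePoly, mul_zero, sub_zero]

namespace Params.Valid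

variable {P : Params}

/-- Solutions of the homogeneous Bethe equations are eigenvectors of the homogeneous operator. -/
lemma isAWImage_of_isHomRoots (hP : P.Valid) {N : ℕ} {w : Fin N → ℂ} (hw : IsHomRoots P w) :
    IsAWImage (P.q ^ 2) P.numHom (bethePoly P.q w)
      (C (awEig (P.q ^ 2) (P.bs / P.cs) N) * bethePoly P.q w) := by
  obtain ⟨r, h1, h2, h3⟩ :=
    hP.exists_isAWImage_numHom N (bethePoly P.q w) (natDegree_bethePoly _ _).le
  have hc : (bethePoly P.q w).coeff N = 1 := by
    have := (monic_bethePoly P.q w).coeff_natDegree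
    rwa [natDegree_bethePoly] at this
  have hr := eq_C_mul_bethePoly hw.1 h1 fun i => by
    rw [← h3 _ (mul_ne_zero hP.q_ne (pow_ne_zero 2 (hw.1.1 i))) (hw.1.sq_ne_one i)]
    exact hP.awOp_eq_zero_of_homBethe hw.1 i (hw.2 i)
  rw [h2, hc, mul_one] at hr
  rwa [← hr]

lemma gridOp_of_isHomRoots (hP : P.Valid)
    (hk : P.bd / P.cd ≠ 1 ∧ P.bd / P.cd ≠ P.q ^ (-(4 * P.n : ℤ)))
    {N : ℕ} {w : Fin N → ℂ} (hw : IsHomRoots P w) {M : ℕ} (hM : M ≤ P.n) :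
    gridOp (P.upCoeff P.numHom) (P.downCoeff P.numHom) (P.gridVal (bethePoly P.q w)) M
      = awEig (P.q ^ 2) (P.bs / P.cs) N * P.gridVal (bethePoly P.q w) M := by
  rw [← hP.awOp_gridPt hk hM hP.numHom_n hP.numHom_zero,
    hP.isAWImage_of_isHomRoots hw _ (hP.gridPt_ne M) (hP.gridPt_sq_ne_one hk hM)]
  simp [gridVal]

/-- The TQ polynomial has degree at most n and vanishes at the n distinct roots of Q, so it is its
leading coefficient times Q. -/
lemma inhomTQ_of_isInhomRoots (hP : P.Valid) {k : ℕ} (hn : P.n = k + 1) {u : Fin P.n → ℂ}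
    (hu : IsInhomRoots P u) {z : ℂ} (hz : z ≠ 0) (h2 : z ^ 2 ≠ 1) :
    P.inhomTQ (bethePoly P.q u) z
      = inhomEigenvalue P u * (bethePoly P.q u).eval (joukowski z) := by
  obtain ⟨T, h1, h2', h3⟩ := hP.exists_inhomTQ hn (monic_bethePoly P.q u)
    (by rw [natDegree_bethePoly, hn])
  have e1 : (bethePoly P.q u).coeff k = -∑ j, (P.q * u j ^ 2 + P.q⁻¹ * u j ^ (-2 : ℤ)) := by
    have := Polynomial.prod_X_sub_C_coeff_card_pred (univ : Finset (Fin P.n))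
      (fun j => joukowski (P.q * u j ^ 2)) (by simp [hn])
    rw [card_univ, Fintype.card_fin, show P.n - 1 = k by omega] at this
    rw [bethePoly, this]
    refine congrArg _ (sum_congr rfl fun j _ => ?_)
    rw [joukowski, mul_inv, zpow_neg]; rfl
  have e2 : (psi (P.q ^ 2) (P.r₀ * P.bd) (k + 1)).coeff k
      = -∑ i ∈ range (k + 1), joukowski (P.gridPt i) := by
    have := Polynomial.prod_X_sub_C_coeff_card_pred (range (k + 1))
      (fun i => joukowski (P.r₀ * P.bd * (P.q ^ 2) ^ i)) (by simp)
    rwa [card_range, Nat.add_sub_cancel] at this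
  rw [e1, e2, neg_sub_neg, hP.leadTQ_eq hn] at h2'
  have hT := eq_C_mul_bethePoly hu.1 (r := T) (by rw [hn]; exact h1) fun i => by
    rw [← h3 _ (mul_ne_zero hP.q_ne (pow_ne_zero 2 (hu.1.1 i))) (hu.1.sq_ne_one i)]
    exact hP.inhomTQ_eq_zero_of_inhomBethe hu.1 i (hu.2 i)
  have h2'' : T.coeff P.n = inhomEigenvalue P u := by rw [← h2', hn]
  rw [h3 z hz h2, hT, h2'']
  simp

lemma qComm_of_isInhomRoots (hP : P.Valid)
    (hk : P.bd / P.cd ≠ 1 ∧ P.bd / P.cd ≠ P.q ^ (-(4 * P.n : ℤ)))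
    {u : Fin P.n → ℂ} (hu : IsInhomRoots P u) {M : ℕ} (hM : M ≤ P.n) :
    P.commCoeff * (P.q * gridOp (P.upCoeff P.numInhom) (P.downCoeff P.numInhom)
        (fun i => joukowski (P.gridPt i) * P.gridVal (bethePoly P.q u) i) M
      - P.q⁻¹ * (joukowski (P.gridPt M)
        * gridOp (P.upCoeff P.numInhom) (P.downCoeff P.numInhom)
          (P.gridVal (bethePoly P.q u)) M)
      + P.commShift * joukowski (P.gridPt M) * P.gridVal (bethePoly P.q u) M)
      = (inhomEigenvalue P u - P.diagConst) * P.gridVal (bethePoly P.q u) M := by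
  -- For n = 0 there is no subleading coefficient. The grid is one point with zero up and down
  -- coefficients, and `diagHalf_add_inv` gives the scalar identity.
  rcases Nat.eq_zero_or_pos P.n with hn | hn
  · have hM0 : M = 0 := by omega
    subst hM0
    have h1 : P.upCoeff P.numInhom 0 = 0 := by
      have := hP.numInhom_n
      rw [hn] at this
      rw [upCoeff, ratCoeff, this, zero_div]
    have h2 : P.downCoeff P.numInhom 0 = 0 := by
      rw [downCoeff, ratCoeff, hP.numInhom_zero, zero_div]
    have h3 := hP.diagHalf_add_inv (hP.gridPt_ne 0) (hP.gridPt_sq_ne_one hk (Nat.zero_le _))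
    have h4 : P.diagHalf (P.gridPt 0) = 0 := by
      rw [diagHalf, hn, inv_mul_cancel₀ (hP.gridPt_ne 0)]; simp
    have h5 : P.diagHalf (P.gridPt 0)⁻¹ = 0 := by
      rw [diagHalf, ← gridPt_zero, mul_inv_cancel₀ (hP.gridPt_ne 0)]; simp
    have h6 : inhomEigenvalue P u = P.bs + P.cs := by
      have : IsEmpty (Fin P.n) := by rw [hn]; infer_instance
      rw [inhomEigenvalue]
      simp [hn, qInt]
    rw [h4, h5] at h3
    rw [hP.qComm_gridOp, h1, h2, h6]
    linear_combination -P.gridVal (bethePoly P.q u) 0 * h3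
  · obtain ⟨k, hk'⟩ := Nat.exists_eq_add_of_lt hn
    rw [zero_add] at hk'
    have h := hP.inhomTQ_of_isInhomRoots hk' hu (hP.gridPt_ne M) (hP.gridPt_sq_ne_one hk hM)
    have hψ : (psi (P.q ^ 2) (P.r₀ * P.bd) (P.n + 1)).eval (joukowski (P.gridPt M)) = 0 := by
      rw [psi, Polynomial.eval_prod]
      exact prod_eq_zero (mem_range.2 (Nat.lt_succ_of_le hM)) (by simp [gridPt])
    have hX : P.gridVal (X * bethePoly P.q u)
        = fun i => joukowski (P.gridPt i) * P.gridVal (bethePoly P.q u) i := by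
      funext i; simp [gridVal]
    rw [inhomTQ, hP.awOp_gridPt hk hM hP.numInhom_n hP.numInhom_zero,
      hP.awOp_gridPt hk hM hP.numInhom_n hP.numInhom_zero, hψ, hX] at h
    change _ + P.diagConst * P.gridVal (bethePoly P.q u) M - _
      = _ * P.gridVal (bethePoly P.q u) M at h
    change P.commCoeff * (_ + _ * P.gridVal (bethePoly P.q u) M) + _ - _ = _ at h
    linear_combination h

/-- A nonzero polynomial of degree at most `n` does not vanish on the grid. -/
lemma eq_zero_of_gridVal (hP : P.Valid)
    (hk : P.bd / P.cd ≠ 1 ∧ P.bd / P.cd ≠ P.q ^ (-(4 * P.n : ℤ))) {p : ℂ[X]}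
    (hp : p.natDegree ≤ P.n) (h : ∀ M ≤ P.n, P.gridVal p M = 0) : p = 0 := by
  refine eq_zero_of_coeff_eq_zero (N := P.n + 1) (hp.trans (Nat.le_succ _))
    (Polynomial.coeff_eq_zero_of_natDegree_lt (Nat.lt_succ_of_le hp))
    (x := fun i => joukowski (P.gridPt i)) ?_ fun i => h i (Nat.lt_succ_iff.1 i.2)
  intro i j hij
  have hi := Nat.lt_succ_iff.1 i.2
  have hj := Nat.lt_succ_iff.1 j.2
  rcases lt_trichotomy (i : ℕ) j with h | h | h
  · exact absurd hij (hP.joukowski_gridPt_injective hk hj h)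
  · exact Fin.ext h
  · exact absurd hij.symm (hP.joukowski_gridPt_injective hk hi h)

/-- The polynomial with roots the rescaled symmetric variables. -/
lemma rootProd_eq (hP : P.Valid) {N : ℕ} (U : Fin N → ℂ) (M : ℕ) :
    rootProd P U M = (-(P.q + P.q⁻¹)⁻¹) ^ N
      * P.gridVal (∏ j, (X - C ((P.q + P.q⁻¹) * U j))) M := by
  have h := hP.q_add_inv_ne
  rw [rootProd, gridVal, Polynomial.eval_prod]
  have hpow : (-(P.q + P.q⁻¹)⁻¹) ^ N = ∏ _j : Fin N, (-(P.q + P.q⁻¹)⁻¹) := by simp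
  rw [hpow, ← prod_mul_distrib]
  refine prod_congr rfl fun j _ => ?_
  rw [hP.joukowski_gridPt]
  simp only [Polynomial.eval_sub, Polynomial.eval_X, Polynomial.eval_C]
  generalize P.q + P.q⁻¹ = s at *
  field_simp
  ring

lemma prod_symVar (hP : P.Valid) {N : ℕ} {u U : Fin N → ℂ} (hU : ∀ j, U j = symVar P.q (u j)) :
    ∏ j, (X - C ((P.q + P.q⁻¹) * U j)) = bethePoly P.q u := by
  rw [bethePoly]
  refine prod_congr rfl fun j _ => ?_
  rw [hU, symVar_eq, mul_div_cancel₀ _ hP.q_add_inv_ne]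

end Params.Valid

/-- The multisets of roots agree; as U is injective there are no repetitions, so matching equal
values defines a bijection of indices. -/
lemma exists_perm_of_prod_eq {s : ℂ} (hs : s ≠ 0) {n : ℕ} {V U : Fin n → ℂ}
    (hU : Function.Injective U)
    (h : ∏ j, (X - C (s * V j)) = ∏ j, (X - C (s * U j))) :
    ∃ σ : Equiv.Perm (Fin n), ∀ j, V j = U (σ j) := by
  have hroots : ∀ W : Fin n → ℂ, (∏ j, (X - C (s * W j)) : ℂ[X]).roots
      = (univ : Finset (Fin n)).val.map fun j => s * W j := by
    intro W
    have := Polynomial.roots_multiset_prod_X_sub_C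
      ((univ : Finset (Fin n)).val.map fun j => s * W j)
    rwa [Multiset.map_map] at this
  have hm : (univ : Finset (Fin n)).val.map (fun j => s * V j)
      = (univ : Finset (Fin n)).val.map fun j => s * U j := by
    rw [← hroots, ← hroots, h]
  have hnodup : ((univ : Finset (Fin n)).val.map fun j => s * V j).Nodup := by
    rw [hm]
    exact (univ : Finset (Fin n)).nodup.map fun i j hij => hU (mul_left_cancel₀ hs hij)
  have hV : Function.Injective V := fun i j hij =>
    Multiset.inj_on_of_nodup_map hnodup i (mem_univ i) j (mem_univ j) (by simp only [hij])
  have hex : ∀ j, ∃ i, U i = V j := by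
    intro j
    have : s * V j ∈ (univ : Finset (Fin n)).val.map fun j => s * U j := by
      rw [← hm]; exact Multiset.mem_map_of_mem _ (mem_univ j)
    obtain ⟨i, _, hi⟩ := Multiset.mem_map.1 this
    exact ⟨i, mul_left_cancel₀ hs hi⟩
  choose σ hσ using hex
  have hinj : Function.Injective σ := fun i j hij => hV (by rw [← hσ i, ← hσ j, hij])
  exact ⟨Equiv.ofBijective σ (Finite.injective_iff_bijective.1 hinj), fun j => (hσ j).symm⟩

end BetheRacah

/-! ### The main theorem. -/

open BetheRacah
open Polynomial (X C)
theorem mainTheorem2 (P : Params) (hP : P.Valid)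
    (hk : P.bd / P.cd ≠ 1 ∧ P.bd / P.cd ≠ P.q ^ (-(4 * P.n : ℤ)))
    (h₀ : ℂ) (hh₀ : h₀ ≠ 0) (N : ℕ) (hN : N ≤ P.n)
    (hyp₁ : HomHypothesis P N) (hyp₂ : InhomHypothesis P)
    (w : Fin N → ℂ) (hw : IsHomRoots P w)
    (u : Fin P.n → ℂ) (hu : IsInhomRoots P u)
    (hθ : inhomEigenvalue P u = eigval P.q P.bs P.cs N)
    (Uh : Fin N → ℂ) (hUh : ∀ j, Uh j = symVar P.q (w j))
    (Ui : Fin P.n → ℂ) (hUi : ∀ j, Ui j = symVar P.q (u j)) :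
    (∑ M ∈ Finset.range (P.n + 1), rootProd P Ui M * kDiamond P M ≠ 0) ∧
    (∑ M ∈ Finset.range (P.n + 1), 1 / hCoeff P h₀ M * rootProd P Uh M * kDiamond P M ≠ 0) ∧
    (∀ M' ∈ Finset.range (P.n + 1),
      rootProd P Ui M' / ∑ M ∈ Finset.range (P.n + 1), rootProd P Ui M * kDiamond P M
        = 1 / hCoeff P h₀ M' * rootProd P Uh M'
          / ∑ M ∈ Finset.range (P.n + 1),
              1 / hCoeff P h₀ M * rootProd P Uh M * kDiamond P M) ∧
    (∀ V : Fin P.n → ℂ,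
      (∑ M ∈ Finset.range (P.n + 1), rootProd P V M * kDiamond P M ≠ 0) →
      (∀ M' ∈ Finset.range (P.n + 1),
        rootProd P V M' / ∑ M ∈ Finset.range (P.n + 1), rootProd P V M * kDiamond P M
          = 1 / hCoeff P h₀ M' * rootProd P Uh M'
            / ∑ M ∈ Finset.range (P.n + 1),
                1 / hCoeff P h₀ M * rootProd P Uh M * kDiamond P M) →
      ∃ σ : Equiv.Perm (Fin P.n), ∀ j, V j = Ui (σ j)) := by
  set Qh := bethePoly P.q w with hQh
  set Qi := bethePoly P.q u with hQi
  set v := P.gridVal Qi with hv_def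
  set f := P.gridVal Qh with hf_def
  have hs := hP.q_add_inv_ne
  have hκ : -(P.q + P.q⁻¹)⁻¹ ≠ 0 := neg_ne_zero.2 (inv_ne_zero hs)
  set κ := -(P.q + P.q⁻¹)⁻¹ with hκ_def
  have hrI : ∀ M, rootProd P Ui M = κ ^ P.n * v M := fun M => by
    rw [hP.rootProd_eq, hP.prod_symVar hUi]
  have hrH : ∀ M, rootProd P Uh M = κ ^ N * f M := fun M => by
    rw [hP.rootProd_eq, hP.prod_symVar hUh]
  have hv := fun M (hM : M ≤ P.n) => hP.qComm_of_isInhomRoots hk hu hM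
  have hf := fun M (hM : M ≤ P.n) => hP.gridOp_of_isHomRoots hk hw hM
  -- A zero first entry would make Q_i vanish at n + 1 distinct points, although it is monic of
  -- degree n.
  have hv0 : v 0 ≠ 0 := fun h0 => (monic_bethePoly P.q u).ne_zero
    (hP.eq_zero_of_gridVal hk (natDegree_bethePoly P.q u).le (hP.grid_eq_zero hk hv h0))
  have hsum : ∑ M ∈ Finset.range (P.n + 1), kDiamond P M * v M ≠ 0 := fun h0 =>
    hv0 (hP.eq_zero_of_sum_kDiamond hk hv h0)
  rw [hθ] at hv
  have hprop := hP.grid_proportional hk hh₀ hf hv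
  have hf0 : f 0 / hCoeff P h₀ 0 ≠ 0 := by
    intro h0
    refine (monic_bethePoly P.q w).ne_zero (hP.eq_zero_of_gridVal hk
      ((natDegree_bethePoly P.q w).le.trans hN) fun M hM => ?_)
    have h1 := hprop M hM
    change v 0 * (f M / hCoeff P h₀ M) = f 0 / hCoeff P h₀ 0 * v M at h1
    rw [h0, zero_mul] at h1
    exact (div_eq_zero_iff.1 ((mul_eq_zero.1 h1).resolve_left hv0)).resolve_right
      (hP.hCoeff_ne_zero hh₀ hM)
  obtain ⟨c, hc, hrel⟩ : ∃ c : ℂ, c ≠ 0 ∧ ∀ M ≤ P.n,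
      1 / hCoeff P h₀ M * rootProd P Uh M = c * rootProd P Ui M := by
    -- The powers of κ account for the different degrees N and n; the rest is the ratio of first
    -- entries. Since c is independent of M, it cancels in the normalized quotients.
    refine ⟨κ ^ N / κ ^ P.n * (f 0 / hCoeff P h₀ 0 / v 0), ?_, fun M hM => ?_⟩
    · exact mul_ne_zero (div_ne_zero (pow_ne_zero _ hκ) (pow_ne_zero _ hκ)) (div_ne_zero hf0 hv0)
    · have h1 := hprop M hM
      change v 0 * (f M / hCoeff P h₀ M) = f 0 / hCoeff P h₀ 0 * v M at h1
      have h2 : f M / hCoeff P h₀ M = f 0 / hCoeff P h₀ 0 / v 0 * v M := by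
        rw [div_mul_eq_mul_div, eq_div_iff hv0, ← h1, mul_comm]
      have h3 : κ ^ N / κ ^ P.n * κ ^ P.n = κ ^ N := div_mul_cancel₀ _ (pow_ne_zero _ hκ)
      rw [hrH, hrI]
      linear_combination κ ^ N * h2 - f 0 / hCoeff P h₀ 0 / v 0 * v M * h3
  have hSi : ∑ M ∈ Finset.range (P.n + 1), rootProd P Ui M * kDiamond P M ≠ 0 := by
    have : ∑ M ∈ Finset.range (P.n + 1), rootProd P Ui M * kDiamond P M
        = κ ^ P.n * ∑ M ∈ Finset.range (P.n + 1), kDiamond P M * v M := by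
      rw [Finset.mul_sum]
      exact Finset.sum_congr rfl fun M _ => by rw [hrI]; ring
    rw [this]
    exact mul_ne_zero (pow_ne_zero _ hκ) hsum
  have hSh : ∑ M ∈ Finset.range (P.n + 1), 1 / hCoeff P h₀ M * rootProd P Uh M * kDiamond P M
      = c * ∑ M ∈ Finset.range (P.n + 1), rootProd P Ui M * kDiamond P M := by
    rw [Finset.mul_sum]
    refine Finset.sum_congr rfl fun M hM => ?_
    rw [hrel M (Nat.lt_succ_iff.1 (Finset.mem_range.1 hM)), mul_assoc]
  have hmain : ∀ M' ∈ Finset.range (P.n + 1),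
      rootProd P Ui M' / ∑ M ∈ Finset.range (P.n + 1), rootProd P Ui M * kDiamond P M
        = 1 / hCoeff P h₀ M' * rootProd P Uh M'
          / ∑ M ∈ Finset.range (P.n + 1),
              1 / hCoeff P h₀ M * rootProd P Uh M * kDiamond P M := by
    intro M' hM'
    rw [hSh, hrel M' (Nat.lt_succ_iff.1 (Finset.mem_range.1 hM')), mul_div_mul_left _ _ hc]
  refine ⟨hSi, by rw [hSh]; exact mul_ne_zero hc hSi, hmain, fun V hV hVrel => ?_⟩
  set S := ∑ M ∈ Finset.range (P.n + 1), rootProd P Ui M * kDiamond P M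
  set S' := ∑ M ∈ Finset.range (P.n + 1), rootProd P V M * kDiamond P M
  have hdegi : (∏ j, (X - C ((P.q + P.q⁻¹) * Ui j))).natDegree = P.n := by
    rw [hP.prod_symVar hUi, natDegree_bethePoly]
  have hdegV : (∏ j, (X - C ((P.q + P.q⁻¹) * V j))).natDegree = P.n := by
    rw [Polynomial.natDegree_prod_of_monic _ _ fun _ _ => Polynomial.monic_X_sub_C _]
    simp only [Polynomial.natDegree_X_sub_C, Finset.sum_const, Finset.card_univ, Fintype.card_fin,
      smul_eq_mul, mul_one]
  have hmi : (∏ j, (X - C ((P.q + P.q⁻¹) * Ui j))).Monic :=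
    Polynomial.monic_prod_of_monic _ _ fun _ _ => Polynomial.monic_X_sub_C _
  have hmV : (∏ j, (X - C ((P.q + P.q⁻¹) * V j))).Monic :=
    Polynomial.monic_prod_of_monic _ _ fun _ _ => Polynomial.monic_X_sub_C _
  have hci := hmi.coeff_natDegree
  have hcV := hmV.coeff_natDegree
  rw [hdegi] at hci
  rw [hdegV] at hcV
  set pV := ∏ j, (X - C ((P.q + P.q⁻¹) * V j)) with hpV
  set pU := ∏ j, (X - C ((P.q + P.q⁻¹) * Ui j)) with hpU
  -- Both sets of relations have the same right-hand side, so pV and pU are proportional on the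
  -- grid; comparing leading coefficients then gives S' / S = 1.
  have hzero : pV - C (S' / S) * pU = 0 := by
    refine hP.eq_zero_of_gridVal hk ?_ fun M hM => ?_
    · exact (Polynomial.natDegree_sub_le_of_le hdegV.le
        ((Polynomial.natDegree_C_mul_le _ _).trans hdegi.le)).trans (max_self _).le
    · have hM' : M ∈ Finset.range (P.n + 1) := Finset.mem_range.2 (Nat.lt_succ_of_le hM)
      have h1 := (hVrel M hM').trans (hmain M hM').symm
      rw [hP.rootProd_eq, hP.rootProd_eq, div_eq_div_iff hV hSi] at h1
      have h2 : P.gridVal pV M * S = P.gridVal pU M * S' := by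
        refine mul_left_cancel₀ (pow_ne_zero P.n hκ) ?_
        linear_combination h1
      have h3 : P.gridVal (pV - C (S' / S) * pU) M
          = P.gridVal pV M - S' / S * P.gridVal pU M := by simp [Params.gridVal]
      rw [h3, sub_eq_zero, div_mul_eq_mul_div, eq_div_iff hSi, h2, mul_comm]
  have h1 : S' / S = 1 := by
    have := congrArg (fun p => Polynomial.coeff p P.n) hzero
    simp only [Polynomial.coeff_sub, Polynomial.coeff_C_mul, hci, hcV, Polynomial.coeff_zero] at this
    linear_combination -this
  rw [h1, C.map_one, one_mul, sub_eq_zero] at hzero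
  refine exists_perm_of_prod_eq hs ?_ hzero
  intro i j hij
  by_contra hne
  exact hu.1.2.2.2 i j hne (by rw [← hUi, ← hUi, hij])
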